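/- Setting. Let $T\ge 1$, and consider the linear time-varying system $x_{t+1}=A_tx_t+B_tu_t+w_t$, $t=0,\dots,T-1$, with $x_t,w_t\in\mathbb R^n$, $u_t\in\mathbb R^m$ and given $x_0$, and the total cost $\sum_{t=1}^T\big(f_t(x_t)+c_t(u_{t-1})\big)$. Norms are Euclidean norms and induced 2-norms. Well-conditioned costs. With positive constants $m_f,\ell_f,m_c,\ell_c$: for $1\le t\le T$ the functions $f_t,c_t$ are twice continuously differentiable, non-negative, and vanish at $0$; $f_t$ is $m_f$-strongly convex for $1\le t\le T$ and $\ell_f$-strongly smooth for $1\le t\le T-1$; $c_t$ is $m_c$-strongly convex and $\ell_c$-strongly smooth for $1\le t\le T$. $(d,\sigma)$-uniform controllability. With an integer $d\ge1$ and positive constants $\sigma,a,b,b'$: $\|A_t\|\le a$, $\|B_t\|\le b$, $\|B_t^\dagger\|\le b'$ (Moore–Penrose inverse) for $0\le t\le T-1$, and for $0\le t\le T-d$ the controllability matrix $M(t,d)=[\Phi(t+d,t+1)B_t,\ \Phi(t+d,t+2)B_{t+1},\dots,\Phi(t+d,t+d)B_{t+d-1}]$, where $\Phi(t_2,t_1)=A_{t_2-1}\cdots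 A_{t_1}$ for $t_2>t_1$ and $\Phi(t_2,t_1)=I$ otherwise, has all its $n$ singular values at least $\sigma$. Predictive control $PC_k$ ($k\le T$). At each time $t<T-k$, minimize $\sum_{\tau=1}^k\big(f_{t+\tau}(y_\tau)+c_{t+\tau}(v_{\tau-1})\big)+F(y_k)$ over the trajectories $y_\tau=A_{t+\tau-1}y_{\tau-1}+B_{t+\tau-1}v_{\tau-1}+w_{t+\tau-1}$, $1\le\tau\le k$, with $y_0=x_t$, and apply $u_t=v_0$. At time $T-k$, solve the same problem with terminal cost $0$ in place of $F$ and apply all of $v_0,\dots,v_{k-1}$. Here $F$ is the indicator of the origin: $F(0)=0$ and $F(x)=+\infty$ for $x\ne0$. Constants. If $a\ne1$ let $$C(p)=\Big(\tfrac{b(a^{p+1}+a-2)}{\sigma^2(a-1)}\sqrt{\tfrac{a^{2p}-1}{a^2-1}}+\tfrac{1+b}{b}\Big)\Big(\tfrac{b\sqrt{a^{2p+2}-(p+1)a^2+p}}{|a^2-1|}+1\Big)+\sqrt{\tfrac{a^{2p+2}-1}{a^2-1}}-\tfrac1b ,$$ and if $a=1$ let $$C(p)=\Big(\tfrac{b\sqrt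 p}{\sigma^2}(\sqrt p+2)+1\Big)\Big(1+b\sqrt{\tfrac{p(p+1)}2}\Big)+\sqrt{p+1}\,\Big(1+\sqrt{\tfrac p2}\Big).$$ With $\ell=\max(\ell_f,\ell_c)$ let $L_2(p)=\ell\,C(p)^2+\ell^2C(p)^4/m_c$, $L_0=\max_{d\le p\le 2d-1}L_2(p)$, $\lambda_0=1-2\big(\sqrt{1+2L_0/m_f}+1\big)^{-1}$, $\lambda=\lambda_0^{1/(2d-1)}$, $C=\frac{2L_0}{m_f}\lambda_0^{-1}$. Theorem. Let the costs be well-conditioned and the system $(d,\sigma)$-uniformly controllable. Let $\varepsilon\in(0,1)$ and let $d\le k\le T$ satisfy $$k\ \ge\ \ln\!\Big(\frac{6C^6}{(1-\varepsilon)\lambda^2(1-\lambda)^2(1-\lambda^2)^2}\Big)\Big/\big(4\ln(1/\lambda)\big).$$ Then $PC_k$ is well defined (the optimization problems along a run have solutions, and a run exists), and its competitive ratio is at most $$1+\lambda^k\Big(1+\frac{24\,C^4(C+1)^2\big(2\ell_f+4(b')^2\ell_c+4a^2(b')^2\ell_c+L_0+\ell_f\big)}{\varepsilon\,\lambda^4(1-\lambda)^2(1-\lambda^2)^2\,m_f}\Big),$$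 that is, the total cost of $PC_k$ is at most this number times the least total cost over all trajectories of the system from $x_0$. For fixed constants this is $1+O(\lambda^k)$. -/

import Mathlib

open scoped BigOperators

noncomputable section

/-- Data of a finite-horizon linear time-varying control problem with state space `ℝⁿ` and input
space `ℝᵐ`: the horizon `T`, the initial state `x0`, and, for each time, the dynamical matrices
(as linear maps between Euclidean spaces, whose norm is the induced 2-norm), the disturbance, and
the state and control costs.  The dynamics are `x (t+1) = A t (x t) + B t (u t) + w t` for
`t < T`, and the stage cost at time `t ∈ {1, …, T}` is `f t (x t) + c t (u (t-1))`. -/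
structure LTVProblem (n m : ℕ) where
  T : ℕ
  x0 : EuclideanSpace ℝ (Fin n)
  A : ℕ → (EuclideanSpace ℝ (Fin n) →L[ℝ] EuclideanSpace ℝ (Fin n))
  B : ℕ → (EuclideanSpace ℝ (Fin m) →L[ℝ] EuclideanSpace ℝ (Fin n))
  w : ℕ → EuclideanSpace ℝ (Fin n)
  f : ℕ → EuclideanSpace ℝ (Fin n) → ℝ
  c : ℕ → EuclideanSpace ℝ (Fin m) → ℝ

/-- `g` is `μ`-strongly convex: the first-order inequality, for a differentiable `g`. -/
def IsStronglyConvex {r : ℕ} (μ : ℝ) (g : EuclideanSpace ℝ (Fin r) → ℝ) : Prop :=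
  ∀ x y, g x + inner ℝ (gradient g x) (y - x) + μ / 2 * ‖y - x‖ ^ 2 ≤ g y

/-- `g` is `ℓ`-strongly smooth: the first-order inequality, for a differentiable `g`. -/
def IsStronglySmooth {r : ℕ} (ℓ : ℝ) (g : EuclideanSpace ℝ (Fin r) → ℝ) : Prop :=
  ∀ x y, g y ≤ g x + inner ℝ (gradient g x) (y - x) + ℓ / 2 * ‖y - x‖ ^ 2

/-- The four Penrose equations: `X` is the Moore–Penrose inverse of `B`. -/
def IsMoorePenroseInverse {n m : ℕ}
    (B : EuclideanSpace ℝ (Fin m) →L[ℝ] EuclideanSpace ℝ (Fin n))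
    (X : EuclideanSpace ℝ (Fin n) →L[ℝ] EuclideanSpace ℝ (Fin m)) : Prop :=
  B ∘L X ∘L B = B ∧ X ∘L B ∘L X = X ∧ IsSelfAdjoint (B ∘L X) ∧ IsSelfAdjoint (X ∘L B)

namespace LTVProblem

variable {n m : ℕ}

/-- Well-conditioned costs: all costs are twice continuously differentiable, non-negative and zero
at the origin; `f t` is `mf`-strongly convex for `1 ≤ t ≤ T` and `ℓf`-strongly smooth for
`1 ≤ t ≤ T - 1`; `c t` is `mc`-strongly convex and `ℓc`-strongly smooth for `1 ≤ t ≤ T`. -/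
structure WellConditioned (S : LTVProblem n m) (mf ℓf mc ℓc : ℝ) : Prop where
  mf_pos : 0 < mf
  ℓf_pos : 0 < ℓf
  mc_pos : 0 < mc
  ℓc_pos : 0 < ℓc
  f_convex : ∀ t, 1 ≤ t → t ≤ S.T → IsStronglyConvex mf (S.f t)
  f_smooth : ∀ t, 1 ≤ t → t < S.T → IsStronglySmooth ℓf (S.f t)
  c_convex : ∀ t, 1 ≤ t → t ≤ S.T → IsStronglyConvex mc (S.c t)
  c_smooth : ∀ t, 1 ≤ t → t ≤ S.T → IsStronglySmooth ℓc (S.c t)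
  f_contDiff : ∀ t, 1 ≤ t → t ≤ S.T → ContDiff ℝ 2 (S.f t)
  c_contDiff : ∀ t, 1 ≤ t → t ≤ S.T → ContDiff ℝ 2 (S.c t)
  f_nonneg : ∀ t, 1 ≤ t → t ≤ S.T → ∀ x, 0 ≤ S.f t x
  c_nonneg : ∀ t, 1 ≤ t → t ≤ S.T → ∀ u, 0 ≤ S.c t u
  f_zero : ∀ t, 1 ≤ t → t ≤ S.T → S.f t 0 = 0
  c_zero : ∀ t, 1 ≤ t → t ≤ S.T → S.c t 0 = 0

/-- `S.steps t j = A (t+j-1) ∘ ⋯ ∘ A t`. -/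
def steps (S : LTVProblem n m) (t : ℕ) :
    ℕ → (EuclideanSpace ℝ (Fin n) →L[ℝ] EuclideanSpace ℝ (Fin n))
  | 0 => ContinuousLinearMap.id ℝ _
  | j + 1 => S.A (t + j) ∘L S.steps t j

/-- The transition matrix `Φ(t₂, t₁) = A (t₂-1) ⋯ A t₁`, the identity if `t₂ ≤ t₁`. -/
def transition (S : LTVProblem n m) (t₂ t₁ : ℕ) :
    EuclideanSpace ℝ (Fin n) →L[ℝ] EuclideanSpace ℝ (Fin n) :=
  S.steps t₁ (t₂ - t₁)

/-- The controllability matrix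
`M(t, p) = [Φ(t+p, t+1) B t, Φ(t+p, t+2) B (t+1), …, Φ(t+p, t+p) B (t+p-1)]`, as a linear map on
the Euclidean space of stacked inputs `(v 0, …, v (p-1))`. -/
def controllability (S : LTVProblem n m) (t p : ℕ) :
    PiLp 2 (fun _ : Fin p => EuclideanSpace ℝ (Fin m)) →L[ℝ] EuclideanSpace ℝ (Fin n) :=
  ∑ i : Fin p, (S.transition (t + p) (t + i + 1) ∘L S.B (t + i)) ∘L
    PiLp.proj 2 (fun _ : Fin p => EuclideanSpace ℝ (Fin m)) i

/-- `(d, σ)`-uniform controllability with bounded dynamics.  The controllability matrix `M(t, d)`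
has `n` rows, and its `n` singular values, which are those of its transpose, are all at least `σ`;
in particular it has full row rank. -/
structure UniformlyControllable (S : LTVProblem n m) (d : ℕ) (σ a b b' : ℝ) : Prop where
  d_pos : 1 ≤ d
  σ_pos : 0 < σ
  a_pos : 0 < a
  b_pos : 0 < b
  b'_pos : 0 < b'
  norm_A : ∀ t, t < S.T → ‖S.A t‖ ≤ a
  norm_B : ∀ t, t < S.T → ‖S.B t‖ ≤ b
  norm_Bdag : ∀ t, t < S.T → ∃ X, IsMoorePenroseInverse (S.B t) X ∧ ‖X‖ ≤ b'
  sigma_min : ∀ t, t + d ≤ S.T → ∀ i, i < n →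
    σ ≤ (ContinuousLinearMap.adjoint (S.controllability t d)).toLinearMap.singularValues i

/-- `(y, v)` is a trajectory of `p` steps from time `t` and state `x`, with disturbances `ζ`.  Only
`y 0, …, y p` and `v 0, …, v (p-1)` matter. -/
def IsTrajectory (S : LTVProblem n m) (t p : ℕ) (x : EuclideanSpace ℝ (Fin n))
    (ζ : ℕ → EuclideanSpace ℝ (Fin n)) (y : ℕ → EuclideanSpace ℝ (Fin n))
    (v : ℕ → EuclideanSpace ℝ (Fin m)) : Prop :=
  y 0 = x ∧ ∀ τ, τ < p → y (τ + 1) = S.A (t + τ) (y τ) + S.B (t + τ) (v τ) + ζ τ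

/-- The cost `∑_{τ=1}^p f (t+τ) (y τ) + c (t+τ) (v (τ-1))` of `p` steps from time `t`. -/
def stepsCost (S : LTVProblem n m) (t p : ℕ) (y : ℕ → EuclideanSpace ℝ (Fin n))
    (v : ℕ → EuclideanSpace ℝ (Fin m)) : ℝ :=
  ∑ τ ∈ Finset.Icc 1 p, (S.f (t + τ) (y τ) + S.c (t + τ) (v (τ - 1)))

/-- `(y, v)` solves the `p`-step problem from time `t` and state `x`, with disturbances `ζ` and
terminal cost `F`: it is a trajectory which minimizes the sum of `stepsCost` and `F (y p)`. -/
def IsOptimal (S : LTVProblem n m) (t p : ℕ) (x : EuclideanSpace ℝ (Fin n))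
    (ζ : ℕ → EuclideanSpace ℝ (Fin n)) (F : EuclideanSpace ℝ (Fin n) → EReal)
    (y : ℕ → EuclideanSpace ℝ (Fin n)) (v : ℕ → EuclideanSpace ℝ (Fin m)) : Prop :=
  S.IsTrajectory t p x ζ y v ∧
    ∀ y' v', S.IsTrajectory t p x ζ y' v' →
      (S.stepsCost t p y v : EReal) + F (y p) ≤ (S.stepsCost t p y' v' : EReal) + F (y' p)

/-- `(x, u)` is a run of predictive control with prediction window `k` and terminal cost `F`.  At
each time `t < T - k` the first input of an optimal `k`-step plan with terminal cost `F` is applied;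
at time `T - k` an optimal `k`-step plan without terminal cost is applied to the end. -/
def IsPredictiveControl (S : LTVProblem n m) (k : ℕ) (F : EuclideanSpace ℝ (Fin n) → EReal)
    (x : ℕ → EuclideanSpace ℝ (Fin n)) (u : ℕ → EuclideanSpace ℝ (Fin m)) : Prop :=
  S.IsTrajectory 0 S.T S.x0 S.w x u ∧
  (∀ t, t + k < S.T → ∃ y v,
    S.IsOptimal t k (x t) (fun τ => S.w (t + τ)) F y v ∧ u t = v 0) ∧
  (∃ y v, S.IsOptimal (S.T - k) k (x (S.T - k)) (fun τ => S.w (S.T - k + τ)) (fun _ => 0) y v ∧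
    ∀ τ, τ < k → u (S.T - k + τ) = v τ)

/-- The total cost `∑_{t=1}^T f t (x t) + c t (u (t-1))`. -/
def cost (S : LTVProblem n m) (x : ℕ → EuclideanSpace ℝ (Fin n))
    (u : ℕ → EuclideanSpace ℝ (Fin m)) : ℝ :=
  S.stepsCost 0 S.T x u

/-- The offline optimal cost: the least total cost over all trajectories of the system. -/
def optCost (S : LTVProblem n m) : ℝ :=
  sInf {r | ∃ x u, S.IsTrajectory 0 S.T S.x0 S.w x u ∧ r = S.cost x u}

end LTVProblem

open Classical in
/-- The indicator function of the origin: `0` at the origin and `+∞` elsewhere. -/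
def originIndicator {n : ℕ} (x : EuclideanSpace ℝ (Fin n)) : EReal :=
  if x = 0 then 0 else ⊤

/-- The constant `C(p)`. -/
def constC (a b σ : ℝ) (p : ℕ) : ℝ :=
  if a = 1 then
    (b * √p / σ ^ 2 * (√p + 2) + 1) * (1 + b * √((p : ℝ) * (p + 1) / 2))
      + √((p : ℝ) + 1) * (1 + √((p : ℝ) / 2))
  else
    (b * (a ^ (p + 1) + a - 2) / (σ ^ 2 * (a - 1)) * √((a ^ (2 * p) - 1) / (a ^ 2 - 1))
        + (1 + b) / b)
      * (b * √(a ^ (2 * p + 2) - (p + 1) * a ^ 2 + p) / |a ^ 2 - 1| + 1)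
      + √((a ^ (2 * p + 2) - 1) / (a ^ 2 - 1)) - 1 / b

/-- The constant `L₂(p) = ℓ C(p)² + ℓ² C(p)⁴ / m_c` with `ℓ = max ℓ_f ℓ_c`. -/
def constL2 (a b σ ℓf mc ℓc : ℝ) (p : ℕ) : ℝ :=
  max ℓf ℓc * constC a b σ p ^ 2 + max ℓf ℓc ^ 2 * constC a b σ p ^ 4 / mc

/-- The constant `L₀ = max_{d ≤ p ≤ 2d-1} L₂(p)`. -/
def constL0 (d : ℕ) (a b σ ℓf mc ℓc : ℝ) : ℝ :=
  sSup (constL2 a b σ ℓf mc ℓc '' Set.Icc d (2 * d - 1))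

/-- The number `λ₀ = 1 - 2 / (√(1 + 2 L₀ / m_f) + 1)`. -/
def rateBase (L0 mf : ℝ) : ℝ := 1 - 2 * (√(1 + 2 * L0 / mf) + 1)⁻¹

/-- The decay rate `λ = λ₀ ^ (1 / (2d-1))`. -/
def decayRate (d : ℕ) (L0 mf : ℝ) : ℝ := rateBase L0 mf ^ (1 / (2 * (d : ℝ) - 1))

/-- The decay constant `C = (2 L₀ / m_f) / λ₀`. -/
def decayConst (L0 mf : ℝ) : ℝ := 2 * L0 / mf * (rateBase L0 mf)⁻¹

end

/-!
# The competitive ratio of predictive control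

The optimal control problems are compared through their first-order conditions only; no second
derivative and no value function is used.

*Perturbation bounds.*  Take two trajectories that are stationary for the cost.  The differences
`δ`, `ω` of their states and inputs follow the homogeneous dynamics, and the differences `g`, `h` of
the cost gradients along them annihilate every admissible homogeneous trajectory.  Over a block of
`p` steps, `d ≤ p ≤ 2d - 1`, controllability gives a steering trajectory between any two states
which depends linearly on them, with norm at most `C(p)`.  Pairing the gradients with the steering
trajectories issued from the two ends of the block yields numbers `α`, `β`, and cocoercivity of the
gradients gives
`(u α + v β)² ≤ ℓ C(p)² (α + β) (u² ‖δ_s‖² + v² ‖δ_e‖²)` for all `u`, `v`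
(`GradientDifference.exists_block`).  A test perturbation which equals `δ` at the block ends, damped
by the factor `λ₀²` from each block to the next, then has a pairing bounded below: by
`weighted_le` a damped block costs at most `m_f / 2` times the squared weighted differences at its
ends, and strong convexity of the state costs returns `m_f` at each end.  This balances exactly
because `λ₀` solves `(1 - λ₀)² L₀ = 2 λ₀ m_f` (`rateBase_critical`) and `ℓ C(p)² ≤ L₀`.  Since the
pairing vanishes by stationarity, perturbations decay by `λ₀` per block of at most `2d - 1` steps:
`norm_sub_le_of_freeStationary` for the initial state, `norm_sub_le_of_fixedStationary` for the
final one.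

*Competitive ratio.*  The first step of a plan that is forced to end at the origin differs from the
clairvoyant step by at most `C λ^(k-1)` times the norm of the clairvoyant state `k` steps ahead.
Telescoping over the clairvoyant continuations of the states of the run, the deviation from the
offline optimum is a discounted sum of these errors, and for `k` as large as assumed the resulting
inequality closes (`sum_sq_deviation_le`).  Costs are compared by `f (y + δ) ≤ (1 + θ) f y +
(1 + 1/θ) (ℓ/2) ‖δ‖²` with `θ = λ^k`; the inputs are controlled through the Moore–Penrose inverse,
because an optimal plan uses a cheapest input among those with the same effect, and the last `k`
steps by steering onto the optimal trajectory.
-/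

noncomputable section

/-! ### Strongly convex and strongly smooth functions -/

section CostFunctions

variable {r : ℕ} {f : EuclideanSpace ℝ (Fin r) → ℝ} {μ ℓ : ℝ}

theorem IsStronglySmooth.mono (h : IsStronglySmooth ℓ f) {ℓ' : ℝ} (hℓ : ℓ ≤ ℓ') :
    IsStronglySmooth ℓ' f := fun x y =>
  (h x y).trans (by gcongr)

theorem IsStronglyConvex.monotone_gradient (h : IsStronglyConvex μ f)
    (x y : EuclideanSpace ℝ (Fin r)) :
    μ * ‖x - y‖ ^ 2 ≤ inner ℝ (gradient f x - gradient f y) (x - y) := by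
  have h1 := h x y
  have h2 := h y x
  rw [norm_sub_rev y x] at h1
  have h3 : inner ℝ (gradient f x) (y - x) = -inner ℝ (gradient f x) (x - y) := by
    rw [← inner_neg_right, neg_sub]
  rw [inner_sub_left]
  linarith

/-- A convex `ℓ`-smooth function lies above its tangent by `‖∇f x - ∇f y‖² / (2ℓ)`: compare the
two first-order inequalities at the point `y - (∇f y - ∇f x) / ℓ`. -/
theorem IsStronglySmooth.add_sq_gradient_le (hμ : 0 ≤ μ) (hℓ : 0 < ℓ) (hc : IsStronglyConvex μ f)
    (hs : IsStronglySmooth ℓ f) (x y : EuclideanSpace ℝ (Fin r)) :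
    f x + inner ℝ (gradient f x) (y - x) + 1 / (2 * ℓ) * ‖gradient f x - gradient f y‖ ^ 2
      ≤ f y := by
  set D := gradient f y - gradient f x with hD
  have h1 := hc x (y - ℓ⁻¹ • D)
  have h2 := hs y (y - ℓ⁻¹ • D)
  have e1 : y - ℓ⁻¹ • D - x = (y - x) - ℓ⁻¹ • D := by abel
  have e2 : y - ℓ⁻¹ • D - y = -(ℓ⁻¹ • D) := by abel
  rw [e1, inner_sub_right, real_inner_smul_right] at h1
  rw [e2, inner_neg_right, norm_neg, norm_smul, real_inner_smul_right, Real.norm_eq_abs,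
    abs_of_pos (inv_pos.2 hℓ)] at h2
  have h3 : inner ℝ (gradient f y) D - inner ℝ (gradient f x) D = ‖D‖ ^ 2 := by
    rw [← inner_sub_left, ← hD, real_inner_self_eq_norm_sq]
  have h4 : 0 ≤ μ / 2 * ‖y - x - ℓ⁻¹ • D‖ ^ 2 := by positivity
  rw [norm_sub_rev (gradient f x)]
  have h5 : ℓ / 2 * (ℓ⁻¹ * ‖D‖) ^ 2 = 1 / (2 * ℓ) * ‖D‖ ^ 2 := by field_simp
  have h6 : ℓ⁻¹ * inner ℝ (gradient f y) D - ℓ⁻¹ * inner ℝ (gradient f x) D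
      = 2 * (1 / (2 * ℓ) * ‖D‖ ^ 2) := by
    rw [← mul_sub, h3]; field_simp
  linarith

theorem IsStronglySmooth.cocoercive (hμ : 0 ≤ μ) (hℓ : 0 < ℓ) (hc : IsStronglyConvex μ f)
    (hs : IsStronglySmooth ℓ f) (x y : EuclideanSpace ℝ (Fin r)) :
    ‖gradient f x - gradient f y‖ ^ 2
      ≤ ℓ * inner ℝ (gradient f x - gradient f y) (x - y) := by
  have h1 := hs.add_sq_gradient_le hμ hℓ hc x y
  have h2 := hs.add_sq_gradient_le hμ hℓ hc y x
  rw [norm_sub_rev (gradient f y)] at h2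
  have h3 : inner ℝ (gradient f x) (y - x) = -inner ℝ (gradient f x) (x - y) := by
    rw [← inner_neg_right, neg_sub]
  have h4 : 1 / (2 * ℓ) * ‖gradient f x - gradient f y‖ ^ 2
      + 1 / (2 * ℓ) * ‖gradient f x - gradient f y‖ ^ 2
      ≤ inner ℝ (gradient f x - gradient f y) (x - y) := by
    rw [inner_sub_left]; linarith
  have h5 := mul_le_mul_of_nonneg_left h4 hℓ.le
  have h6 : ℓ * (1 / (2 * ℓ) * ‖gradient f x - gradient f y‖ ^ 2
      + 1 / (2 * ℓ) * ‖gradient f x - gradient f y‖ ^ 2)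
      = ‖gradient f x - gradient f y‖ ^ 2 := by field_simp; ring
  linarith

theorem IsStronglySmooth.sq_gradient_le (hℓ : 0 < ℓ) (hs : IsStronglySmooth ℓ f)
    (h0 : ∀ x, 0 ≤ f x) (x : EuclideanSpace ℝ (Fin r)) :
    ‖gradient f x‖ ^ 2 ≤ 2 * ℓ * f x := by
  have h1 := hs x (x - ℓ⁻¹ • gradient f x)
  have e2 : x - ℓ⁻¹ • gradient f x - x = -(ℓ⁻¹ • gradient f x) := by abel
  rw [e2, inner_neg_right, norm_neg, norm_smul, real_inner_smul_right, Real.norm_eq_abs,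
    abs_of_pos (inv_pos.2 hℓ), real_inner_self_eq_norm_sq] at h1
  have h2 := h0 (x - ℓ⁻¹ • gradient f x)
  have h5 : ℓ⁻¹ * ‖gradient f x‖ ^ 2 - ℓ / 2 * (ℓ⁻¹ * ‖gradient f x‖) ^ 2
      = ‖gradient f x‖ ^ 2 / (2 * ℓ) := by field_simp; ring
  have h6 : ‖gradient f x‖ ^ 2 / (2 * ℓ) ≤ f x := by linarith
  rw [div_le_iff₀ (by positivity)] at h6
  linarith

/-- Multiplicative perturbation bound for a non-negative smooth function. -/
theorem IsStronglySmooth.add_le (hℓ : 0 < ℓ) (hs : IsStronglySmooth ℓ f)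
    (h0 : ∀ x, 0 ≤ f x) {η : ℝ} (hη : 0 < η) (x δ : EuclideanSpace ℝ (Fin r)) :
    f (x + δ) ≤ (1 + η) * f x + (1 + 1 / η) * (ℓ / 2 * ‖δ‖ ^ 2) := by
  have h1 := hs x (x + δ)
  rw [add_sub_cancel_left] at h1
  have h2 := hs.sq_gradient_le hℓ h0 x
  have h3 := real_inner_le_norm (gradient f x) δ
  have h4 : ‖gradient f x‖ * ‖δ‖ ≤ η * ‖gradient f x‖ ^ 2 / (2 * ℓ) + ℓ / (2 * η) * ‖δ‖ ^ 2 := by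
    rw [div_add' _ _ _ (by positivity), le_div_iff₀ (by positivity)]
    have : ℓ / (2 * η) * ‖δ‖ ^ 2 * (2 * ℓ) = (ℓ * ‖δ‖) ^ 2 / η := by field_simp
    rw [this, ← sub_nonneg]
    have : η * ‖gradient f x‖ ^ 2 + (ℓ * ‖δ‖) ^ 2 / η - ‖gradient f x‖ * ‖δ‖ * (2 * ℓ)
        = (η * ‖gradient f x‖ - ℓ * ‖δ‖) ^ 2 / η := by field_simp; ring
    rw [this]; positivity
  have h5 : η * ‖gradient f x‖ ^ 2 / (2 * ℓ) ≤ η * f x := by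
    rw [div_le_iff₀ (by positivity)]
    nlinarith
  have h6 : (1 + 1 / η) * (ℓ / 2 * ‖δ‖ ^ 2) = ℓ / 2 * ‖δ‖ ^ 2 + ℓ / (2 * η) * ‖δ‖ ^ 2 := by
    field_simp
  linarith

theorem gradient_eq_zero_of_nonneg (h0 : ∀ x, 0 ≤ f x) (hz : f 0 = 0) : gradient f 0 = 0 := by
  have : IsLocalMin f 0 := Filter.Eventually.of_forall fun x => by rw [hz]; exact h0 x
  rw [gradient, this.fderiv_eq_zero, map_zero]

theorem IsStronglyConvex.sq_norm_le (hc : IsStronglyConvex μ f) (h0 : ∀ x, 0 ≤ f x)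
    (hz : f 0 = 0) (x : EuclideanSpace ℝ (Fin r)) : μ / 2 * ‖x‖ ^ 2 ≤ f x := by
  have := hc 0 x
  rw [hz, gradient_eq_zero_of_nonneg h0 hz] at this
  simpa using this

theorem hasDerivAt_comp_line (hf : Differentiable ℝ f) (x v : EuclideanSpace ℝ (Fin r)) :
    HasDerivAt (fun θ : ℝ => f (x + θ • v)) (inner ℝ (gradient f x) v) 0 := by
  have h1 : HasDerivAt (fun θ : ℝ => x + θ • v) v 0 := by
    simpa using ((hasDerivAt_id (0 : ℝ)).smul_const v).const_add x
  have h2 := (hf x).hasGradientAt.hasFDerivAt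
  have h3 : HasFDerivAt f (InnerProductSpace.toDual ℝ _ (gradient f x)) (x + (0 : ℝ) • v) := by
    simpa using h2
  exact h3.comp_hasDerivAt 0 h1

theorem IsStronglyConvex.le_of_isStronglySmooth [NeZero r] (hc : IsStronglyConvex μ f)
    (hs : IsStronglySmooth ℓ f) : μ ≤ ℓ := by
  obtain ⟨v, hv⟩ := exists_norm_eq (EuclideanSpace ℝ (Fin r)) zero_le_one
  have := (hc 0 v).trans (hs 0 v)
  simp only [sub_zero, hv] at this
  linarith

end CostFunctions

/-! ### The constants -/

section Constants

theorem sum_sum_pow_mul_sq_sub_one (a : ℝ) (p : ℕ) :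
    (∑ j ∈ Finset.range p, ∑ i ∈ Finset.range (j + 1), a ^ (2 * i)) * (a ^ 2 - 1) ^ 2
      = a ^ (2 * p + 2) - (p + 1) * a ^ 2 + p := by
  induction p with
  | zero => simp
  | succ p ih =>
    have h : (∑ i ∈ Finset.range (p + 1), a ^ (2 * i)) * (a ^ 2 - 1) = a ^ (2 * p + 2) - 1 := by
      have := geom_sum_mul (a ^ 2) (p + 1)
      simp only [← pow_mul] at this
      rw [this]; ring_nf
    rw [Finset.sum_range_succ, add_mul, ih, pow_two (a ^ 2 - 1), ← mul_assoc, h]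
    push_cast; ring

/-- The three quantities on the left are the norm of the minimal steering input, the norm of the
map from inputs to states, and the norm of the free response. -/
theorem add_le_constC {a b σ : ℝ} (ha : 0 < a) (hb : 0 < b) (hσ : 0 < σ) (p : ℕ) :
    1 + (b * √(∑ i ∈ Finset.range p, a ^ (2 * i)) / σ ^ 2 * (1 + a ^ p)
        * (1 + b * √(∑ j ∈ Finset.range p, ∑ i ∈ Finset.range (j + 1), a ^ (2 * i)))
      + √(∑ j ∈ Finset.range (p + 1), a ^ (2 * j))) ≤ constC a b σ p := by
  unfold constC
  by_cases h1 : a = 1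
  · subst h1
    rw [if_pos rfl]
    have e1 : ∑ i ∈ Finset.range p, (1 : ℝ) ^ (2 * i) = p := by simp
    have e2 : ∑ j ∈ Finset.range p, ∑ i ∈ Finset.range (j + 1), (1 : ℝ) ^ (2 * i)
        = (p : ℝ) * (p + 1) / 2 := by
      simp only [one_pow, Finset.sum_const, Finset.card_range, nsmul_eq_mul, mul_one]
      clear e1
      induction p with
      | zero => simp
      | succ p ih => rw [Finset.sum_range_succ, ih]; push_cast; ring
    have e3 : ∑ i ∈ Finset.range (p + 1), (1 : ℝ) ^ (2 * i) = p + 1 := by simp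
    rw [e1, e2, e3, one_pow]
    set G := √((p : ℝ) * (p + 1) / 2)
    set V := b * √(p : ℝ) / σ ^ 2
    have hG : 0 ≤ G := Real.sqrt_nonneg _
    have hV : 0 ≤ V := by positivity
    have hp : 0 ≤ √(p : ℝ) := Real.sqrt_nonneg _
    have hS : 0 ≤ √((p : ℝ) + 1) * √((p : ℝ) / 2) := by positivity
    have hbG : 0 ≤ b * G := by positivity
    have : V * (1 + 1) * (1 + b * G) ≤ V * (√p + 2) * (1 + b * G) := by
      have : (1 : ℝ) + 1 ≤ √p + 2 := by linarith
      gcongr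
    nlinarith
  · rw [if_neg h1]
    have hsq : a ^ 2 - 1 ≠ 0 := by
      intro h
      apply h1
      nlinarith [sq_nonneg (a - 1)]
    have e1 : ∀ q : ℕ, ∑ i ∈ Finset.range q, a ^ (2 * i) = (a ^ (2 * q) - 1) / (a ^ 2 - 1) := by
      intro q
      have := geom_sum_mul (a ^ 2) q
      simp only [← pow_mul] at this
      rw [eq_div_iff hsq, this]
    have e2 : √(∑ j ∈ Finset.range p, ∑ i ∈ Finset.range (j + 1), a ^ (2 * i))
        = √(a ^ (2 * p + 2) - (p + 1) * a ^ 2 + p) / |a ^ 2 - 1| := by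
      rw [← Real.sqrt_sq_eq_abs, ← Real.sqrt_div' _ (sq_nonneg _),
        ← sum_sum_pow_mul_sq_sub_one, mul_div_cancel_right₀ _ (pow_ne_zero _ hsq)]
    have e4 : (a ^ (p + 1) + a - 2) / (a - 1) = 1 + ∑ i ∈ Finset.range (p + 1), a ^ i := by
      have h2 : a - 1 ≠ 0 := sub_ne_zero.2 h1
      have := geom_sum_mul a (p + 1)
      rw [div_eq_iff h2, add_mul, this]; ring
    have e5 : a ^ p ≤ ∑ i ∈ Finset.range (p + 1), a ^ i := by
      rw [Finset.sum_range_succ]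
      have : 0 ≤ ∑ i ∈ Finset.range p, a ^ i := Finset.sum_nonneg fun i _ => by positivity
      linarith
    rw [e2, e1 p, e1 (p + 1), mul_div_assoc b (√_) |a ^ 2 - 1|]
    have e6 : 2 * (p + 1) = 2 * p + 2 := by ring
    rw [e6]
    set G := √(a ^ (2 * p + 2) - (p + 1) * a ^ 2 + p) / |a ^ 2 - 1|
    set R := √((a ^ (2 * p) - 1) / (a ^ 2 - 1))
    have hG : 0 ≤ G := by positivity
    have hR : 0 ≤ R := Real.sqrt_nonneg _
    have e7 : b * (a ^ (p + 1) + a - 2) / (σ ^ 2 * (a - 1)) * R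
        = b * R / σ ^ 2 * (1 + ∑ i ∈ Finset.range (p + 1), a ^ i) := by
      rw [← e4, div_mul_div_comm, div_mul_eq_mul_div]; ring
    rw [e7]
    have h3 : b * R / σ ^ 2 * (1 + a ^ p) ≤
        b * R / σ ^ 2 * (1 + ∑ i ∈ Finset.range (p + 1), a ^ i) := by gcongr
    have h4 := mul_le_mul_of_nonneg_right h3 (by positivity : 0 ≤ 1 + b * G)
    have h5 : (1 + b) / b * (b * G + 1) = G + b * G + 1 + 1 / b := by field_simp; ring
    have h6 : 0 ≤ b * G := by positivity
    linarith

theorem one_le_constC {a b σ : ℝ} (ha : 0 < a) (hb : 0 < b) (hσ : 0 < σ) (p : ℕ) :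
    1 ≤ constC a b σ p := by
  refine le_trans ?_ (add_le_constC ha hb hσ p)
  have : 0 ≤ b * √(∑ i ∈ Finset.range p, a ^ (2 * i)) / σ ^ 2 * (1 + a ^ p)
        * (1 + b * √(∑ j ∈ Finset.range p, ∑ i ∈ Finset.range (j + 1), a ^ (2 * i)))
      + √(∑ j ∈ Finset.range (p + 1), a ^ (2 * j)) := by positivity
  linarith

theorem le_constL0 {d : ℕ} {a b σ ℓf mc ℓc : ℝ} (hmc : 0 < mc) {p : ℕ} (hp : d ≤ p)
    (hp' : p ≤ 2 * d - 1) :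
    max ℓf ℓc * constC a b σ p ^ 2 ≤ constL0 d a b σ ℓf mc ℓc := by
  have h1 : constL2 a b σ ℓf mc ℓc p ≤ constL0 d a b σ ℓf mc ℓc :=
    le_csSup ((Set.finite_Icc _ _).image _).bddAbove ⟨p, ⟨hp, hp'⟩, rfl⟩
  refine le_trans ?_ h1
  have : 0 ≤ max ℓf ℓc ^ 2 * constC a b σ p ^ 4 / mc := by positivity
  unfold constL2
  linarith

variable {L m : ℝ}

theorem rateBase_mem (hL : 0 < L) (hm : 0 < m) : 0 < rateBase L m ∧ rateBase L m < 1 := by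
  unfold rateBase
  have h1 : 1 < √(1 + 2 * L / m) := by
    rw [Real.lt_sqrt one_pos.le]
    have : 0 < 2 * L / m := by positivity
    linarith
  constructor
  · rw [sub_pos, ← div_eq_mul_inv, div_lt_one (by linarith)]
    linarith
  · have : 0 < (√(1 + 2 * L / m) + 1)⁻¹ := by positivity
    linarith

/-- `λ₀` solves the critical equation for which the exponentially weighted energy stays
nonnegative. -/
theorem rateBase_critical (hL : 0 < L) (hm : 0 < m) :
    (1 - rateBase L m) ^ 2 * L = 2 * rateBase L m * m := by
  unfold rateBase
  set s := √(1 + 2 * L / m) with hs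
  have h1 : s ^ 2 = 1 + 2 * L / m := Real.sq_sqrt (by positivity)
  have h2 : 0 ≤ s := Real.sqrt_nonneg _
  have h3 : L = m * (s ^ 2 - 1) / 2 := by rw [h1]; field_simp; ring
  rw [h3]
  field_simp
  ring

theorem decayConst_mul_rateBase (hL : 0 < L) (hm : 0 < m) :
    decayConst L m * rateBase L m = 2 * L / m := by
  have := (rateBase_mem hL hm).1.ne'
  unfold decayConst
  field_simp

theorem decayConst_ge_one (hL : 0 < L) (hm : 0 < m) : 1 ≤ decayConst L m := by
  have h1 := rateBase_critical hL hm
  obtain ⟨h2, h3⟩ := rateBase_mem hL hm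
  have h4 := decayConst_mul_rateBase hL hm
  have h5 : decayConst L m * rateBase L m * (1 - rateBase L m) ^ 2 = 4 * rateBase L m := by
    rw [h4]; field_simp; linarith
  have h6 : decayConst L m * (1 - rateBase L m) ^ 2 = 4 := by
    apply mul_right_cancel₀ h2.ne'; linarith
  by_contra! h7
  have : (1 - rateBase L m) ^ 2 ≤ 1 := by nlinarith
  nlinarith [sq_nonneg (1 - rateBase L m)]

theorem decayRate_mem {d : ℕ} (hd : 1 ≤ d) (hL : 0 < L) (hm : 0 < m) :
    0 < decayRate d L m ∧ decayRate d L m < 1 := by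
  obtain ⟨h2, h3⟩ := rateBase_mem hL hm
  have hd' : (1 : ℝ) ≤ d := by exact_mod_cast hd
  have : 0 < 1 / (2 * (d : ℝ) - 1) := by
    apply one_div_pos.2; linarith
  exact ⟨Real.rpow_pos_of_pos h2 _, Real.rpow_lt_one h2.le h3 this⟩

theorem decayRate_pow {d : ℕ} (hd : 1 ≤ d) (hL : 0 < L) (hm : 0 < m) :
    decayRate d L m ^ (2 * d - 1) = rateBase L m := by
  have hd' : (1 : ℝ) ≤ d := by exact_mod_cast hd
  unfold decayRate
  rw [← Real.rpow_natCast, ← Real.rpow_mul (rateBase_mem hL hm).1.le, Nat.cast_sub (by omega)]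
  push_cast
  rw [one_div_mul_cancel (by linarith), Real.rpow_one]

/-- From an energy estimate over `N` blocks covering `h` steps to decay over `h` steps. -/
theorem le_decayConst_mul_pow {d : ℕ} (hd : 1 ≤ d) (hm : 0 < m) (hL : m ≤ L) {N h : ℕ}
    (hN : 1 ≤ N) (hh : h ≤ N * (2 * d - 1)) {X Y : ℝ} (hY : 0 ≤ Y)
    (hXY : m * X ^ 2 ≤ (rateBase L m ^ 2) ^ (N - 1) * (L * Y ^ 2)) :
    X ≤ decayConst L m * decayRate d L m ^ h * Y := by
  have hL' : 0 < L := hm.trans_le hL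
  obtain ⟨h2, h3⟩ := rateBase_mem hL' hm
  obtain ⟨h4, h5⟩ := decayRate_mem hd hL' hm
  have hC := decayConst_ge_one hL' hm
  have h6 : rateBase L m ^ N ≤ decayRate d L m ^ h := by
    rw [← decayRate_pow hd hL' hm, ← pow_mul]
    exact pow_le_pow_of_le_one h4.le h5.le (by rw [mul_comm]; exact hh)
  have h7 : X ≤ decayConst L m * rateBase L m ^ N * Y := by
    have e : decayConst L m * rateBase L m ^ N * Y = rateBase L m ^ (N - 1) * (2 * L / m * Y) := by
      obtain ⟨j, rfl⟩ : ∃ j, N = j + 1 := ⟨N - 1, by omega⟩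
      rw [← decayConst_mul_rateBase hL' hm, Nat.add_sub_cancel, pow_succ]; ring
    rw [e]
    refine le_of_sq_le_sq ?_ (by positivity)
    refine le_of_mul_le_mul_left ?_ hm
    refine hXY.trans ?_
    have e' : m * (rateBase L m ^ (N - 1) * (2 * L / m * Y)) ^ 2
        = (rateBase L m ^ 2) ^ (N - 1) * (m * (2 * L / m * Y) ^ 2) := by ring
    rw [e']
    refine mul_le_mul_of_nonneg_left ?_ (pow_nonneg (sq_nonneg _) _)
    have : m * (2 * L / m * Y) ^ 2 = 4 * L ^ 2 / m * Y ^ 2 := by field_simp; ring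
    rw [this]
    refine mul_le_mul_of_nonneg_right ?_ (by positivity)
    rw [le_div_iff₀ hm]
    nlinarith
  refine h7.trans ?_
  gcongr

end Constants

/-! ### Scalar estimates for one block -/

section Edge

variable {L m α β X Y r : ℝ}

/-- Weighted lower bound for the interaction of the two ends of a block.  With
`c = (r + 1/r) / 2` one has
`(α + β) (r² α + β) = (1 + c)/2 (r α + β)² - (c - 1)/2 (r α - β)²`. -/
theorem weighted_le (hm : 0 ≤ m) (hr : 0 < r) (hcrit : (1 - r) ^ 2 * L ≤ 2 * r * m) (hs : 0 ≤ α + β)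
    (hX : 0 ≤ X) (hY : 0 ≤ Y)
    (h : ∀ s t : ℝ, (s * α + t * β) ^ 2 ≤ L * (α + β) * (s ^ 2 * X + t ^ 2 * Y)) :
    -(m / 2) * (r ^ 2 * X + Y) ≤ r ^ 2 * α + β := by
  rcases hs.eq_or_lt with h0 | h0
  · have h1 := h 1 0
    have h2 := h 0 1
    rw [← h0] at h1 h2
    have hα : α = 0 := by nlinarith
    have hβ : β = 0 := by nlinarith
    subst hα hβ
    have : 0 ≤ m / 2 * (r ^ 2 * X + Y) := by positivity
    linarith
  · have h1 := h r (-1)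
    have key : 4 * r * ((α + β) * (r ^ 2 * α + β))
        = (1 + r) ^ 2 * (r * α + β) ^ 2 - (1 - r) ^ 2 * (r * α - β) ^ 2 := by ring
    have h2 : (1 - r) ^ 2 * (r * α - β) ^ 2 ≤ 2 * r * m * ((α + β) * (r ^ 2 * X + Y)) := by
      calc (1 - r) ^ 2 * (r * α - β) ^ 2
          ≤ (1 - r) ^ 2 * (L * (α + β) * (r ^ 2 * X + Y)) := by
            apply mul_le_mul_of_nonneg_left _ (sq_nonneg _)
            refine le_trans (le_of_eq ?_) (h1.trans (le_of_eq ?_)) <;> ring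
        _ = ((1 - r) ^ 2 * L) * ((α + β) * (r ^ 2 * X + Y)) := by ring
        _ ≤ _ := by gcongr
    have h3 : 0 ≤ (1 + r) ^ 2 * (r * α + β) ^ 2 := by positivity
    have h4 : 0 ≤ 4 * r * (α + β) * (r ^ 2 * α + β + m / 2 * (r ^ 2 * X + Y)) := by nlinarith
    have h5 := nonneg_of_mul_nonneg_right h4 (by positivity)
    linarith

/-- The pairing with the steering trajectory issued from one end of a block is bounded below in terms
of the difference at the other end alone. -/
theorem end_le (hs : 0 ≤ α + β)
    (h : ∀ s t : ℝ, (s * α + t * β) ^ 2 ≤ L * (α + β) * (s ^ 2 * X + t ^ 2 * Y))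
    (hL : 0 ≤ L) (hY : 0 ≤ Y) :
    -(L / 4) * Y ≤ α := by
  rcases hs.eq_or_lt with h0 | h0
  · have h1 := h 1 0
    rw [← h0] at h1
    have hα : α = 0 := by nlinarith
    subst hα
    have : 0 ≤ L / 4 * Y := by positivity
    linarith
  · have h1 := h 0 1
    have h4 : 0 ≤ (α + β) * (α + L / 4 * Y) := by nlinarith [sq_nonneg (2 * α + β)]
    have h5 := nonneg_of_mul_nonneg_right h4 h0
    linarith

end Edge

/-! ### Steering -/

theorem LinearMap.sq_mul_sq_norm_le_of_le_singularValues {E F : Type*} [NormedAddCommGroup E]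
    [InnerProductSpace ℝ E] [FiniteDimensional ℝ E] [NormedAddCommGroup F] [InnerProductSpace ℝ F]
    [FiniteDimensional ℝ F] (T : E →ₗ[ℝ] F) {n : ℕ} (hn : Module.finrank ℝ E = n) {σ : ℝ}
    (hσ : 0 ≤ σ) (h : ∀ i, i < n → σ ≤ T.singularValues i) (z : E) :
    σ ^ 2 * ‖z‖ ^ 2 ≤ ‖T z‖ ^ 2 := by
  have hT := T.isSymmetric_adjoint_comp_self
  set B := hT.eigenvectorBasis hn
  have h1 : ‖T z‖ ^ 2 = inner ℝ ((LinearMap.adjoint T ∘ₗ T) z) z := by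
    rw [LinearMap.comp_apply, LinearMap.adjoint_inner_left, real_inner_self_eq_norm_sq]
  rw [h1, ← B.repr.inner_map_map, ← B.repr.norm_map z, EuclideanSpace.norm_sq_eq,
    PiLp.inner_apply, Finset.mul_sum]
  refine Finset.sum_le_sum fun i _ => ?_
  rw [hT.eigenvectorBasis_apply_self_apply hn z i, ← T.sq_singularValues_fin hn i]
  simp only [RCLike.ofReal_real_eq_id, Real.norm_eq_abs, sq_abs, RCLike.inner_apply,
    conj_trivial]
  have h2 : σ ^ 2 ≤ T.singularValues i ^ 2 := pow_le_pow_left₀ hσ (h i i.2) 2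
  have h3 := mul_le_mul_of_nonneg_right h2 (sq_nonneg (B.repr z i))
  refine h3.trans (le_of_eq ?_)
  simp only [B, _root_.id]
  ring

/-- A map whose adjoint is bounded below by `σ` has the right inverse `M* (M M*)⁻¹`, of norm at
most `‖M‖ / σ²`. -/
theorem exists_rightInverse_of_adjoint_bounded_below {V E : Type*} [NormedAddCommGroup V]
    [InnerProductSpace ℝ V] [FiniteDimensional ℝ V] [NormedAddCommGroup E] [InnerProductSpace ℝ E]
    [FiniteDimensional ℝ E] (M : V →L[ℝ] E) {σ β : ℝ} (hσ : 0 < σ) (hβ : 0 ≤ β)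
    (hM : ∀ v, ‖M v‖ ≤ β * ‖v‖)
    (h : ∀ z, σ ^ 2 * ‖z‖ ^ 2 ≤ ‖ContinuousLinearMap.adjoint M z‖ ^ 2) :
    ∃ R : E →ₗ[ℝ] V, (∀ z, M (R z) = z) ∧ ∀ z, ‖R z‖ ≤ β / σ ^ 2 * ‖z‖ := by
  set N : E →ₗ[ℝ] E := (M ∘L ContinuousLinearMap.adjoint M).toLinearMap with hN
  have hN' : ∀ y, inner ℝ y (N y) = ‖ContinuousLinearMap.adjoint M y‖ ^ 2 := fun y => by
    rw [hN, ContinuousLinearMap.coe_coe, ContinuousLinearMap.comp_apply,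
      ← ContinuousLinearMap.adjoint_inner_left, real_inner_self_eq_norm_sq]
  have hbd : ∀ y, σ ^ 2 * ‖y‖ ≤ ‖N y‖ := fun y => by
    have h1 := (h y).trans_eq (hN' y).symm
    have h2 := h1.trans (real_inner_le_norm _ _)
    rcases (norm_nonneg y).eq_or_lt with h0 | h0
    · rw [← h0]; simp
    · nlinarith
  have hinj : Function.Injective N := by
    rw [← LinearMap.ker_eq_bot, LinearMap.ker_eq_bot']
    intro y hy
    have := hbd y
    rw [hy, norm_zero] at this
    have h0 : ‖y‖ ≤ 0 := by
      by_contra! h3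
      have : 0 < σ ^ 2 * ‖y‖ := by positivity
      linarith
    exact norm_le_zero_iff.1 h0
  let e : E ≃ₗ[ℝ] E := LinearEquiv.ofInjectiveEndo N hinj
  have he : ∀ z, N (e.symm z) = z := fun z => e.apply_symm_apply z
  refine ⟨(ContinuousLinearMap.adjoint M).toLinearMap ∘ₗ e.symm.toLinearMap, fun z => he z,
    fun z => ?_⟩
  have hadj : ‖ContinuousLinearMap.adjoint M‖ ≤ β := by
    rw [LinearIsometryEquiv.norm_map]
    exact M.opNorm_le_bound hβ hM
  have h1 := hbd (e.symm z)
  rw [he] at h1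
  have h2 : ‖e.symm z‖ ≤ ‖z‖ / σ ^ 2 := by
    rw [le_div_iff₀ (by positivity)]; linarith
  calc ‖ContinuousLinearMap.adjoint M (e.symm z)‖ ≤ β * ‖e.symm z‖ :=
        (ContinuousLinearMap.adjoint M).le_of_opNorm_le hadj _
    _ ≤ β * (‖z‖ / σ ^ 2) := by gcongr
    _ = β / σ ^ 2 * ‖z‖ := by ring

namespace LTVProblem

variable {n m : ℕ} {S : LTVProblem n m}

/-- `(η, ν)` obeys the homogeneous dynamics `η (t+1) = A t (η t) + B t (ν t)` for `s ≤ t < e`.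
Times are absolute. -/
def Homogeneous (S : LTVProblem n m) (s e : ℕ) (η : ℕ → EuclideanSpace ℝ (Fin n))
    (ν : ℕ → EuclideanSpace ℝ (Fin m)) : Prop :=
  ∀ t, s ≤ t → t < e → η (t + 1) = S.A t (η t) + S.B t (ν t)

section

variable {s e : ℕ} {η η' : ℕ → EuclideanSpace ℝ (Fin n)} {ν ν' : ℕ → EuclideanSpace ℝ (Fin m)}

theorem Homogeneous.mono (h : S.Homogeneous s e η ν) {s' e' : ℕ} (hs : s ≤ s') (he : e' ≤ e) :
    S.Homogeneous s' e' η ν := fun t h1 h2 => h t (hs.trans h1) (h2.trans_le he)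

theorem Homogeneous.sub (h : S.Homogeneous s e η ν) (h' : S.Homogeneous s e η' ν') :
    S.Homogeneous s e (η - η') (ν - ν') := fun t h1 h2 => by
  simp only [Pi.sub_apply, map_sub, h t h1 h2, h' t h1 h2]; abel

theorem Homogeneous.add (h : S.Homogeneous s e η ν) (h' : S.Homogeneous s e η' ν') :
    S.Homogeneous s e (η + η') (ν + ν') := fun t h1 h2 => by
  simp only [Pi.add_apply, map_add, h t h1 h2, h' t h1 h2]; abel

theorem Homogeneous.smul (h : S.Homogeneous s e η ν) (c : ℝ) :
    S.Homogeneous s e (c • η) (c • ν) := fun t h1 h2 => by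
  simp only [Pi.smul_apply, map_smul, h t h1 h2, smul_add]

theorem transition_succ_comp {t₁ t₂ : ℕ} (h : t₁ ≤ t₂) :
    S.transition (t₂ + 1) t₁ = S.A t₂ ∘L S.transition t₂ t₁ := by
  obtain ⟨j, rfl⟩ := Nat.exists_eq_add_of_le h
  have : t₁ + j + 1 - t₁ = j + 1 := by omega
  simp [transition, this, steps]

theorem transition_self (t : ℕ) : S.transition t t = ContinuousLinearMap.id ℝ _ := by
  simp [transition, steps]

theorem Homogeneous.apply_eq_sum (h : S.Homogeneous s e η ν) (h0 : η s = 0) (j : ℕ)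
    (hj : s + j ≤ e) :
    η (s + j) = ∑ i ∈ Finset.range j,
      S.transition (s + j) (s + i + 1) (S.B (s + i) (ν (s + i))) := by
  induction j with
  | zero => simpa using h0
  | succ j ih =>
    rw [← add_assoc, h (s + j) (by omega) (by omega), ih (by omega), Finset.sum_range_succ,
      map_sum, transition_self]
    congr 1
    refine Finset.sum_congr rfl fun i hi => ?_
    rw [Finset.mem_range] at hi
    rw [transition_succ_comp (by omega)]
    rfl

theorem Homogeneous.apply_eq_controllability (h : S.Homogeneous s e η ν) (h0 : η s = 0) {p : ℕ}
    (hp : s + p ≤ e) {v : PiLp 2 (fun _ : Fin p => EuclideanSpace ℝ (Fin m))}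
    (hv : ∀ i : Fin p, ν (s + i) = v i) :
    η (s + p) = S.controllability s p v := by
  rw [h.apply_eq_sum h0 p hp, Finset.sum_range]
  simp [controllability, hv]

theorem Homogeneous.norm_le {a b : ℝ} (ha : 0 ≤ a) (hb : 0 ≤ b)
    (hA : ∀ t, t < S.T → ‖S.A t‖ ≤ a) (hB : ∀ t, t < S.T → ‖S.B t‖ ≤ b)
    (h : S.Homogeneous s e η ν) (he : e ≤ S.T) (j : ℕ) (hj : s + j ≤ e) :
    ‖η (s + j)‖ ≤ a ^ j * ‖η s‖
      + b * √(∑ i ∈ Finset.range j, a ^ (2 * i)) * √(∑ i ∈ Finset.range j, ‖ν (s + i)‖ ^ 2) := by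
  induction j with
  | zero => simp
  | succ j ih =>
    rw [← add_assoc, h (s + j) (by omega) (by omega)]
    have h1 : ‖S.A (s + j) (η (s + j))‖ ≤ a * ‖η (s + j)‖ :=
      (S.A (s + j)).le_of_opNorm_le (hA _ (by omega)) _
    have h2 : ‖S.B (s + j) (ν (s + j))‖ ≤ b * ‖ν (s + j)‖ :=
      (S.B (s + j)).le_of_opNorm_le (hB _ (by omega)) _
    have h3 := ih (by omega)
    have e1 : ∑ i ∈ Finset.range (j + 1), a ^ (2 * i)
        = a ^ 2 * ∑ i ∈ Finset.range j, a ^ (2 * i) + 1 := by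
      rw [Finset.sum_range_succ', Finset.mul_sum]
      congr 1
      refine Finset.sum_congr rfl fun i _ => ?_
      ring
    rw [e1, Finset.sum_range_succ]
    set g := ∑ i ∈ Finset.range j, a ^ (2 * i) with hg
    set N := ∑ i ∈ Finset.range j, ‖ν (s + i)‖ ^ 2 with hN
    have hg0 : 0 ≤ g := Finset.sum_nonneg fun i _ => by positivity
    have hN0 : 0 ≤ N := Finset.sum_nonneg fun i _ => by positivity
    have h4 : a * (√g * √N) + ‖ν (s + j)‖ ≤ √(a ^ 2 * g + 1) * √(N + ‖ν (s + j)‖ ^ 2) := by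
      rw [← Real.sqrt_mul (x := a ^ 2 * g + 1) (by positivity)]
      apply Real.le_sqrt_of_sq_le
      have e2 : √g ^ 2 = g := Real.sq_sqrt hg0
      have e3 : √N ^ 2 = N := Real.sq_sqrt hN0
      generalize √g = G at e2
      generalize √N = K at e3
      rw [← e2, ← e3]
      nlinarith [sq_nonneg (a * G * ‖ν (s + j)‖ - K)]
    have h5 : a * ‖η (s + j)‖ ≤ a * (a ^ j * ‖η s‖ + b * √g * √N) := by gcongr
    have h6 := mul_le_mul_of_nonneg_left h4 hb
    calc _ ≤ a * ‖η (s + j)‖ + b * ‖ν (s + j)‖ := (norm_add_le _ _).trans (add_le_add h1 h2)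
      _ ≤ _ := by rw [pow_succ]; linarith

end

/-- The states `η (s+j)` of the homogeneous system, as linear maps, when the initial state and the
inputs are linear maps on a parameter space. -/
def response (S : LTVProblem n m) {W : Type*} [AddCommGroup W] [Module ℝ W] (s : ℕ)
    (ξ : W →ₗ[ℝ] EuclideanSpace ℝ (Fin n)) (ν : ℕ → (W →ₗ[ℝ] EuclideanSpace ℝ (Fin m))) :
    ℕ → (W →ₗ[ℝ] EuclideanSpace ℝ (Fin n))
  | 0 => ξ
  | j + 1 => (S.A (s + j)).toLinearMap ∘ₗ S.response s ξ ν j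
      + (S.B (s + j)).toLinearMap ∘ₗ ν (s + j)

theorem homogeneous_response {W : Type*} [AddCommGroup W] [Module ℝ W] (s e : ℕ)
    (ξ : W →ₗ[ℝ] EuclideanSpace ℝ (Fin n)) (ν : ℕ → (W →ₗ[ℝ] EuclideanSpace ℝ (Fin m))) (w : W) :
    S.Homogeneous s e (fun t => S.response s ξ ν (t - s) w) (fun t => ν t w) := by
  intro t hs _
  obtain ⟨j, rfl⟩ := Nat.exists_eq_add_of_le hs
  have : s + j + 1 - s = j + 1 := by omega
  simp [this, response]

variable {d : ℕ} {σ a b b' : ℝ}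

theorem UniformlyControllable.exists_rightInverse (h : S.UniformlyControllable d σ a b b') {t : ℕ}
    (ht : t + d ≤ S.T) :
    ∃ R : EuclideanSpace ℝ (Fin n) →ₗ[ℝ] PiLp 2 (fun _ : Fin d => EuclideanSpace ℝ (Fin m)),
      (∀ z, S.controllability t d (R z) = z) ∧
      ∀ z, ‖R z‖ ≤ b * √(∑ i ∈ Finset.range d, a ^ (2 * i)) / σ ^ 2 * ‖z‖ := by
  have hb := h.b_pos
  refine exists_rightInverse_of_adjoint_bounded_below _ h.σ_pos (by positivity) (fun v => ?_)
    (fun z => LinearMap.sq_mul_sq_norm_le_of_le_singularValues _ finrank_euclideanSpace_fin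
      h.σ_pos.le (h.sigma_min t ht) z)
  set ν : ℕ → (PiLp 2 (fun _ : Fin d => EuclideanSpace ℝ (Fin m)) →ₗ[ℝ] EuclideanSpace ℝ (Fin m)) :=
    fun τ => if hτ : τ - t < d then
      (PiLp.proj 2 (𝕜 := ℝ) (fun _ : Fin d => EuclideanSpace ℝ (Fin m)) ⟨τ - t, hτ⟩).toLinearMap
      else 0 with hν
  have hom := S.homogeneous_response t (t + d) 0 ν v
  have hνv : ∀ i : Fin d, ν (t + i) v = v i := fun i => by
    simp [hν]
  have h1 := hom.apply_eq_controllability (by simp [response]) le_rfl hνv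
  have h2 := hom.norm_le h.a_pos.le h.b_pos.le h.norm_A h.norm_B ht d le_rfl
  have h3 : ∑ i ∈ Finset.range d, ‖ν (t + i) v‖ ^ 2 = ‖v‖ ^ 2 := by
    rw [Finset.sum_range, PiLp.norm_sq_eq_of_L2]
    exact Finset.sum_congr rfl fun i _ => by rw [hνv i]
  rw [h1, h3, Real.sqrt_sq (norm_nonneg _)] at h2
  simpa [response] using h2

/-- Minkowski's inequality for inputs of norm `N` and states bounded by free and forced responses
with weights `α` and `β`. -/
theorem sq_add_sq_le_of_sum_le {p : ℕ} {α β y : ℕ → ℝ} {X N Q c V : ℝ} (hX : 0 ≤ X) (hN : 0 ≤ N)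
    (hy : ∀ j ∈ Finset.range p, 0 ≤ y j) (hyle : ∀ j ∈ Finset.range p, y j ≤ α j * X + β j * N)
    (hXQ : X ≤ Q) (hNQ : N ≤ V * Q) (hQ : 0 ≤ Q)
    (hc : V * (1 + √(∑ j ∈ Finset.range p, β j ^ 2)) + √(∑ j ∈ Finset.range p, α j ^ 2) ≤ c) :
    N ^ 2 + ∑ j ∈ Finset.range p, y j ^ 2 ≤ c ^ 2 * Q ^ 2 := by
  have h1 : ∑ j ∈ Finset.range p, y j ^ 2 ≤ ∑ j ∈ Finset.range p, (α j * X + β j * N) ^ 2 :=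
    Finset.sum_le_sum fun j hj => pow_le_pow_left₀ (hy j hj) (hyle j hj) 2
  have h2 : ∑ j ∈ Finset.range p, (α j * X + β j * N) ^ 2
      = (∑ j ∈ Finset.range p, α j ^ 2) * X ^ 2 + 2 * (X * N) * (∑ j ∈ Finset.range p, α j * β j)
        + (∑ j ∈ Finset.range p, β j ^ 2) * N ^ 2 := by
    rw [Finset.sum_mul, Finset.sum_mul, Finset.mul_sum, ← Finset.sum_add_distrib,
      ← Finset.sum_add_distrib]
    exact Finset.sum_congr rfl fun j _ => by ring
  have h3 := Real.sum_mul_le_sqrt_mul_sqrt (Finset.range p) α β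
  have hA := Real.sq_sqrt (Finset.sum_nonneg fun j (_ : j ∈ Finset.range p) => sq_nonneg (α j))
  have hB := Real.sq_sqrt (Finset.sum_nonneg fun j (_ : j ∈ Finset.range p) => sq_nonneg (β j))
  set A := √(∑ j ∈ Finset.range p, α j ^ 2)
  set B := √(∑ j ∈ Finset.range p, β j ^ 2)
  have hA0 : 0 ≤ A := Real.sqrt_nonneg _
  have hB0 : 0 ≤ B := Real.sqrt_nonneg _
  rw [h2, ← hA, ← hB] at h1
  have h4 : 2 * (X * N) * (∑ j ∈ Finset.range p, α j * β j) ≤ 2 * (X * N) * (A * B) := by gcongr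
  have h5 : ∑ j ∈ Finset.range p, y j ^ 2 ≤ (A * X + B * N) ^ 2 := by nlinarith
  have h6 : N + (A * X + B * N) ≤ c * Q := by
    calc N + (A * X + B * N) = (1 + B) * N + A * X := by ring
      _ ≤ (1 + B) * (V * Q) + A * Q := by gcongr
      _ = (V * (1 + B) + A) * Q := by ring
      _ ≤ c * Q := by gcongr
  have h7 : 0 ≤ N * (A * X + B * N) := by positivity
  calc N ^ 2 + ∑ j ∈ Finset.range p, y j ^ 2 ≤ (N + (A * X + B * N)) ^ 2 := by nlinarith
    _ ≤ (c * Q) ^ 2 := by gcongr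
    _ = c ^ 2 * Q ^ 2 := by ring

/-- Steering in `p ≥ d` steps: coast for `p - d` steps, then apply the input of least norm that
reaches the target.  The trajectory depends linearly on its two end points, and the constant `C(p)`
bounds the norm of this dependence. -/
theorem UniformlyControllable.exists_steering (h : S.UniformlyControllable d σ a b b') {s p : ℕ}
    (hdp : d ≤ p) (hT : s + p ≤ S.T) :
    ∃ (η : ℕ → (EuclideanSpace ℝ (Fin n) × EuclideanSpace ℝ (Fin n) →ₗ[ℝ]
          EuclideanSpace ℝ (Fin n)))
      (ν : ℕ → (EuclideanSpace ℝ (Fin n) × EuclideanSpace ℝ (Fin n) →ₗ[ℝ]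
          EuclideanSpace ℝ (Fin m))),
      ∀ w, S.Homogeneous s (s + p) (fun t => η t w) (fun t => ν t w) ∧ η s w = w.1 ∧
        η (s + p) w = w.2 ∧
        ∑ j ∈ Finset.range p, ‖ν (s + j) w‖ ^ 2 + ∑ j ∈ Finset.range p, ‖η (s + j + 1) w‖ ^ 2
          ≤ constC a b σ p ^ 2 * (‖w.1‖ ^ 2 + ‖w.2‖ ^ 2) := by
  obtain ⟨q, rfl⟩ := Nat.exists_eq_add_of_le' hdp
  obtain ⟨R, hR, hRn⟩ := h.exists_rightInverse (t := s + q) (by omega)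
  have ha := h.a_pos
  have hb := h.b_pos
  have hσ := h.σ_pos
  set E := EuclideanSpace ℝ (Fin n)
  set φ := S.response s (LinearMap.fst ℝ E E) 0 with hφ
  set ρ : E × E →ₗ[ℝ] PiLp 2 (fun _ : Fin d => EuclideanSpace ℝ (Fin m)) :=
    R ∘ₗ (LinearMap.snd ℝ E E - φ (q + d)) with hρ
  set ν : ℕ → (E × E →ₗ[ℝ] EuclideanSpace ℝ (Fin m)) :=
    fun τ => if hτ : s + q ≤ τ ∧ τ - (s + q) < d then
      (PiLp.proj 2 (𝕜 := ℝ) (fun _ : Fin d => EuclideanSpace ℝ (Fin m))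
        ⟨τ - (s + q), hτ.2⟩).toLinearMap ∘ₗ ρ
      else 0 with hν
  have hν0 : ∀ j, j < q → ν (s + j) = 0 := fun j hj => by
    simp only [hν]; rw [dif_neg]; omega
  have hν1 : ∀ w, ∀ i : Fin d, ν (s + q + i) w = ρ w i := fun w i => by
    simp [hν]
  have hsum : ∀ w, ∑ j ∈ Finset.range (q + d), ‖ν (s + j) w‖ ^ 2 = ‖ρ w‖ ^ 2 := fun w => by
    rw [Finset.sum_range_add, Finset.sum_eq_zero, zero_add, Finset.sum_range,
      PiLp.norm_sq_eq_of_L2]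
    · exact Finset.sum_congr rfl fun i _ => by rw [← add_assoc, hν1 w i]
    · intro j hj
      rw [hν0 j (Finset.mem_range.1 hj)]; simp
  have hfree : ∀ w, S.Homogeneous s (s + (q + d)) (fun t => φ (t - s) w) (fun _ => 0) := fun w =>
    S.homogeneous_response s _ _ _ w
  refine ⟨fun t => S.response s (LinearMap.fst ℝ E E) ν (t - s), ν, fun w => ?_⟩
  have hom := S.homogeneous_response s (s + (q + d)) (LinearMap.fst ℝ E E) ν w
  have hz0 : ∀ j, j ≤ q → S.response s (LinearMap.fst ℝ E E) ν j w = φ j w := by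
    intro j hj
    induction j with
    | zero => rfl
    | succ j ih =>
      simp only [response, hφ, hν0 j (by omega), LinearMap.add_apply, LinearMap.comp_apply,
        LinearMap.zero_apply, Pi.zero_apply]
      rw [ih (by omega)]
  have hend : S.response s (LinearMap.fst ℝ E E) ν (q + d) w = w.2 := by
    have h1 := (hom.sub (hfree w)).mono (s' := s + q) (e' := s + (q + d)) (by omega) le_rfl
    have h2 := h1.apply_eq_controllability (p := d) (v := ρ w)
      (by simp [hz0 q le_rfl]) (by omega) (fun i => by simp [hν1 w i])
    have e : s + q + d - s = q + d := by omega
    rw [hρ, LinearMap.comp_apply, hR] at h2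
    simp only [Pi.sub_apply, e, LinearMap.sub_apply, LinearMap.snd_apply] at h2
    exact sub_left_injective h2
  have e0 : S.response s (LinearMap.fst ℝ E E) ν (s - s) w = w.1 := by
    simp [response]
  refine ⟨hom, e0, by simpa using hend, ?_⟩
  rw [hsum]
  set Q := √(‖w.1‖ ^ 2 + ‖w.2‖ ^ 2) with hQ
  have hQ2 : Q ^ 2 = ‖w.1‖ ^ 2 + ‖w.2‖ ^ 2 := Real.sq_sqrt (by positivity)
  have hQ0 : 0 ≤ Q := Real.sqrt_nonneg _
  have hx : ‖w.1‖ ≤ Q := Real.le_sqrt_of_sq_le (by linarith [sq_nonneg ‖w.2‖])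
  have hz : ‖w.2‖ ≤ Q := Real.le_sqrt_of_sq_le (by linarith [sq_nonneg ‖w.1‖])
  have hφn : ‖φ (q + d) w‖ ≤ a ^ (q + d) * Q := by
    have := (hfree w).norm_le ha.le hb.le h.norm_A h.norm_B hT (q + d) le_rfl
    simp only [add_tsub_cancel_left, norm_zero] at this
    have e1 : φ (s - s) w = w.1 := by simp [hφ, response]
    rw [e1] at this
    simp only [ne_eq, OfNat.ofNat_ne_zero, not_false_eq_true, zero_pow, Finset.sum_const_zero,
      Real.sqrt_zero, mul_zero, add_zero] at this
    exact this.trans (by gcongr)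
  have hSd : √(∑ i ∈ Finset.range d, a ^ (2 * i)) ≤ √(∑ i ∈ Finset.range (q + d), a ^ (2 * i)) :=
    Real.sqrt_le_sqrt (Finset.sum_le_sum_of_subset_of_nonneg
      (Finset.range_mono (by omega)) fun i _ _ => by positivity)
  have hρn : ‖ρ w‖ ≤ (b * √(∑ i ∈ Finset.range (q + d), a ^ (2 * i)) / σ ^ 2 * (1 + a ^ (q + d)))
      * Q := by
    calc ‖ρ w‖ ≤ b * √(∑ i ∈ Finset.range d, a ^ (2 * i)) / σ ^ 2 * ‖w.2 - φ (q + d) w‖ :=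
          hRn _
      _ ≤ b * √(∑ i ∈ Finset.range (q + d), a ^ (2 * i)) / σ ^ 2 * (Q + a ^ (q + d) * Q) := by
          gcongr
          exact (norm_sub_le _ _).trans (add_le_add hz hφn)
      _ = _ := by ring
  rw [← hQ2]
  refine sq_add_sq_le_of_sum_le (α := fun j => a ^ (j + 1))
    (β := fun j => b * √(∑ i ∈ Finset.range (j + 1), a ^ (2 * i))) (norm_nonneg w.1)
    (norm_nonneg _) (fun j _ => norm_nonneg _) (fun j hj => ?_) hx hρn hQ0 ?_
  · have hj' := Finset.mem_range.1 hj
    have h1 := hom.norm_le ha.le hb.le h.norm_A h.norm_B hT (j + 1) (by omega)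
    rw [e0] at h1
    rw [add_assoc]
    refine h1.trans ?_
    have h2 : √(∑ i ∈ Finset.range (j + 1), ‖ν (s + i) w‖ ^ 2) ≤ ‖ρ w‖ := by
      rw [← Real.sqrt_sq (norm_nonneg (ρ w)), ← hsum w]
      exact Real.sqrt_le_sqrt (Finset.sum_le_sum_of_subset_of_nonneg
        (Finset.range_mono (by omega)) fun i _ _ => by positivity)
    gcongr
  · refine le_trans ?_ (add_le_constC ha hb hσ (q + d))
    have e1 : ∑ j ∈ Finset.range (q + d), (b * √(∑ i ∈ Finset.range (j + 1), a ^ (2 * i))) ^ 2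
        = b ^ 2 * ∑ j ∈ Finset.range (q + d), ∑ i ∈ Finset.range (j + 1), a ^ (2 * i) := by
      rw [Finset.mul_sum]
      refine Finset.sum_congr rfl fun j _ => ?_
      rw [mul_pow, Real.sq_sqrt (Finset.sum_nonneg fun i _ => by positivity)]
    have e2 : ∑ j ∈ Finset.range (q + d), (a ^ (j + 1)) ^ 2
        ≤ ∑ j ∈ Finset.range (q + d + 1), a ^ (2 * j) := by
      rw [Finset.sum_range_succ']
      simp only [mul_zero, pow_zero]
      refine le_add_of_le_of_nonneg (Finset.sum_le_sum fun j _ => le_of_eq (by ring)) zero_le_one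
    rw [e1, Real.sqrt_mul (sq_nonneg b), Real.sqrt_sq hb.le]
    have := Real.sqrt_le_sqrt e2
    linarith

/-! ### Test perturbations -/

/-- The pairing of a homogeneous trajectory with costates: `g t` is paired with the state at time
`t ∈ (s, e]`, and `h t` with the input at time `t ∈ [s, e)`. -/
def pairing (g : ℕ → EuclideanSpace ℝ (Fin n)) (h : ℕ → EuclideanSpace ℝ (Fin m)) (s e : ℕ)
    (η : ℕ → EuclideanSpace ℝ (Fin n)) (ν : ℕ → EuclideanSpace ℝ (Fin m)) : ℝ :=
  ∑ t ∈ Finset.Ico s e, (inner ℝ (g (t + 1)) (η (t + 1)) + inner ℝ (h t) (ν t))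

/-- Some homogeneous trajectory from `x` at time `s` to `z` at time `e` has pairing `v` with the
costates `(g, h)`. -/
def Attains (S : LTVProblem n m) (g : ℕ → EuclideanSpace ℝ (Fin n))
    (h : ℕ → EuclideanSpace ℝ (Fin m)) (s e : ℕ) (x z : EuclideanSpace ℝ (Fin n)) (v : ℝ) : Prop :=
  ∃ η ν, S.Homogeneous s e η ν ∧ η s = x ∧ η e = z ∧ pairing g h s e η ν = v

section Attains

variable {g : ℕ → EuclideanSpace ℝ (Fin n)} {h : ℕ → EuclideanSpace ℝ (Fin m)} {s e f : ℕ}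
  {x x' y z z' : EuclideanSpace ℝ (Fin n)} {v v' : ℝ}

theorem pairing_add (η η' : ℕ → EuclideanSpace ℝ (Fin n)) (ν ν' : ℕ → EuclideanSpace ℝ (Fin m)) :
    pairing g h s e (η + η') (ν + ν') = pairing g h s e η ν + pairing g h s e η' ν' := by
  unfold pairing
  rw [← Finset.sum_add_distrib]
  refine Finset.sum_congr rfl fun t _ => ?_
  simp only [Pi.add_apply, inner_add_right]; ring

theorem pairing_smul (c : ℝ) (η : ℕ → EuclideanSpace ℝ (Fin n))
    (ν : ℕ → EuclideanSpace ℝ (Fin m)) :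
    pairing g h s e (c • η) (c • ν) = c * pairing g h s e η ν := by
  unfold pairing
  rw [Finset.mul_sum]
  refine Finset.sum_congr rfl fun t _ => ?_
  simp only [Pi.smul_apply, real_inner_smul_right]; ring

theorem Attains.add (h₁ : S.Attains g h s e x z v) (h₂ : S.Attains g h s e x' z' v') :
    S.Attains g h s e (x + x') (z + z') (v + v') := by
  obtain ⟨η, ν, a1, rfl, rfl, rfl⟩ := h₁
  obtain ⟨η', ν', b1, rfl, rfl, rfl⟩ := h₂
  exact ⟨η + η', ν + ν', a1.add b1, rfl, rfl, pairing_add _ _ _ _⟩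

theorem Attains.smul (h₁ : S.Attains g h s e x z v) (c : ℝ) :
    S.Attains g h s e (c • x) (c • z) (c * v) := by
  obtain ⟨η, ν, a1, rfl, rfl, rfl⟩ := h₁
  exact ⟨c • η, c • ν, a1.smul c, rfl, rfl, pairing_smul _ _ _⟩

theorem attains_zero (s e : ℕ) : S.Attains g h s e 0 0 0 :=
  ⟨0, 0, fun t _ _ => by simp, rfl, rfl, by simp [pairing]⟩

theorem Attains.trans (hse : s ≤ e) (hef : e ≤ f) (h₁ : S.Attains g h s e x y v)
    (h₂ : S.Attains g h e f y z v') : S.Attains g h s f x z (v + v') := by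
  obtain ⟨η, ν, a1, a2, a3, a4⟩ := h₁
  obtain ⟨η', ν', b1, b2, b3, b4⟩ := h₂
  refine ⟨fun t => if t < e then η t else η' t, fun t => if t < e then ν t else ν' t,
    fun t ht ht' => ?_, ?_, ?_, ?_⟩
  · rcases lt_trichotomy (t + 1) e with h1 | h1 | h1
    · simp only [h1, if_true, (by omega : t < e)]
      exact a1 t ht (by omega)
    · have := a1 t ht (by omega)
      simp only [h1, lt_irrefl, if_false, (by omega : t < e), if_true]
      rw [h1] at this
      rw [← this, a3, b2]
    · have i1 : ¬ t + 1 < e := by omega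
      have i2 : ¬ t < e := by omega
      simp only [if_neg i1, if_neg i2]
      exact b1 t (by omega) ht'
  · dsimp only
    split_ifs with h1
    · exact a2
    · obtain rfl : s = e := by omega
      rw [b2, ← a3, a2]
  · dsimp only
    rw [if_neg (by omega), b3]
  · rw [← a4, ← b4]
    unfold pairing
    rw [← Finset.sum_Ico_consecutive _ hse hef]
    congr 1
    · refine Finset.sum_congr rfl fun t ht => ?_
      rw [Finset.mem_Ico] at ht
      rcases lt_or_ge (t + 1) e with h1 | h1
      · simp only [h1, ht.2, if_true]
      · obtain rfl : e = t + 1 := by omega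
        simp only [lt_irrefl, if_false, ht.2, if_true]
        rw [a3, b2]
    · refine Finset.sum_congr rfl fun t ht => ?_
      rw [Finset.mem_Ico] at ht
      have i1 : ¬ t + 1 < e := by omega
      have i2 : ¬ t < e := by omega
      simp only [if_neg i1, if_neg i2]

end Attains

/-- `(g, h)` annihilates the homogeneous trajectories which vanish at both ends of `[s, e]`: the
first-order optimality condition with prescribed end points. -/
def FixedStationary (S : LTVProblem n m) (g : ℕ → EuclideanSpace ℝ (Fin n))
    (h : ℕ → EuclideanSpace ℝ (Fin m)) (s e : ℕ) : Prop :=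
  ∀ v, S.Attains g h s e 0 0 v → v = 0

/-- `(g, h)` annihilates the homogeneous trajectories on `[s, e]` which vanish at time `s`: the
first-order optimality condition with a free end point. -/
def FreeStationary (S : LTVProblem n m) (g : ℕ → EuclideanSpace ℝ (Fin n))
    (h : ℕ → EuclideanSpace ℝ (Fin m)) (s e : ℕ) : Prop :=
  ∀ z v, S.Attains g h s e 0 z v → v = 0

section Stationary

variable {g : ℕ → EuclideanSpace ℝ (Fin n)} {h : ℕ → EuclideanSpace ℝ (Fin m)} {s e s' e' : ℕ}

theorem FreeStationary.fixedStationary (H : S.FreeStationary g h s e) : S.FixedStationary g h s e :=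
  fun v hv => H 0 v hv

theorem FreeStationary.mono_left (H : S.FreeStationary g h s e) (hs : s ≤ s') (he : s' ≤ e) :
    S.FreeStationary g h s' e := fun z v hv =>
  H z v (by simpa using (attains_zero s s').trans hs he hv)

theorem FixedStationary.mono (H : S.FixedStationary g h s e) (hs : s ≤ s') (hse : s' ≤ e')
    (he : e' ≤ e) : S.FixedStationary g h s' e' := fun v hv => by
  have h1 := (attains_zero s s').trans hs hse hv
  have h2 := h1.trans (hs.trans hse) he (attains_zero e' e)
  exact H v (by simpa using h2)

end Stationary

/-- The differences of two trajectories on `[s, e]` and of the cost gradients along them: states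
`δ`, inputs `ω`, state gradients `g`, input gradients `h`.  The gradients are cocoercive with
constant `ℓ`, except at the final state, and monotone with constant `μ` in the states. -/
structure GradientDifference (S : LTVProblem n m) (μ ℓ : ℝ) (s e : ℕ)
    (δ : ℕ → EuclideanSpace ℝ (Fin n)) (ω : ℕ → EuclideanSpace ℝ (Fin m))
    (g : ℕ → EuclideanSpace ℝ (Fin n)) (h : ℕ → EuclideanSpace ℝ (Fin m)) : Prop where
  hom : S.Homogeneous s e δ ω
  mono : ∀ t, s < t → t ≤ e → μ * ‖δ t‖ ^ 2 ≤ inner ℝ (g t) (δ t)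
  coco_state : ∀ t, s < t → t < e → ‖g t‖ ^ 2 ≤ ℓ * inner ℝ (g t) (δ t)
  coco_input : ∀ t, s ≤ t → t < e → ‖h t‖ ^ 2 ≤ ℓ * inner ℝ (h t) (ω t)

namespace GradientDifference

variable {μ ℓ : ℝ} {s e : ℕ} {δ g : ℕ → EuclideanSpace ℝ (Fin n)}
  {ω h : ℕ → EuclideanSpace ℝ (Fin m)}

theorem restrict (H : S.GradientDifference μ ℓ s e δ ω g h) {s' e' : ℕ} (hs : s ≤ s')
    (he : e' ≤ e) : S.GradientDifference μ ℓ s' e' δ ω g h where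
  hom := H.hom.mono hs he
  mono t h1 h2 := H.mono t (by omega) (by omega)
  coco_state t h1 h2 := H.coco_state t (by omega) (by omega)
  coco_input t h1 h2 := H.coco_input t (by omega) (by omega)

theorem attains (H : S.GradientDifference μ ℓ s e δ ω g h) :
    S.Attains g h s e (δ s) (δ e) (pairing g h s e δ ω) :=
  ⟨δ, ω, H.hom, rfl, rfl, rfl⟩

theorem input_nonneg (hℓ : 0 < ℓ) (H : S.GradientDifference μ ℓ s e δ ω g h) {t : ℕ} (h1 : s ≤ t)
    (h2 : t < e) : 0 ≤ inner ℝ (h t) (ω t) :=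
  nonneg_of_mul_nonneg_right ((sq_nonneg _).trans (H.coco_input t h1 h2)) hℓ

theorem term_nonneg (hμ : 0 ≤ μ) (hℓ : 0 < ℓ) (H : S.GradientDifference μ ℓ s e δ ω g h) {t : ℕ}
    (h1 : s ≤ t) (h2 : t < e) :
    0 ≤ inner ℝ (g (t + 1)) (δ (t + 1)) + inner ℝ (h t) (ω t) :=
  add_nonneg (le_trans (by positivity) (H.mono (t + 1) (by omega) (by omega)))
    (H.input_nonneg hℓ h1 h2)

theorem pairing_nonneg (hμ : 0 ≤ μ) (hℓ : 0 < ℓ) (H : S.GradientDifference μ ℓ s e δ ω g h) :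
    0 ≤ pairing g h s e δ ω :=
  Finset.sum_nonneg fun t ht => by
    rw [Finset.mem_Ico] at ht
    exact H.term_nonneg hμ hℓ ht.1 ht.2

theorem sq_norm_le_pairing (hμ : 0 ≤ μ) (hℓ : 0 < ℓ) (H : S.GradientDifference μ ℓ s e δ ω g h)
    {t : ℕ} (h1 : s < t) (h2 : t ≤ e) : μ * ‖δ t‖ ^ 2 ≤ pairing g h s e δ ω := by
  obtain ⟨t, rfl⟩ : ∃ j, t = j + 1 := ⟨t - 1, by omega⟩
  have h3 := Finset.single_le_sum
    (f := fun t => inner ℝ (g (t + 1)) (δ (t + 1)) + inner ℝ (h t) (ω t))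
    (s := Finset.Ico s e) (fun t ht => by
      rw [Finset.mem_Ico] at ht
      exact H.term_nonneg hμ hℓ ht.1 ht.2) (Finset.mem_Ico.2 ⟨by omega, by omega⟩ : t ∈ _)
  have h4 := H.mono (t + 1) h1 h2
  have h5 := H.input_nonneg hℓ (by omega : s ≤ t) (by omega)
  unfold pairing
  linarith

theorem sq_norm_add_le_pairing (hμ : 0 ≤ μ) (hℓ : 0 < ℓ)
    (H : S.GradientDifference μ ℓ s e δ ω g h) {t : ℕ} (h1 : s < t) (h2 : t < e) :
    μ * ‖δ t‖ ^ 2 + inner ℝ (g e) (δ e) ≤ pairing g h s e δ ω := by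
  obtain ⟨e, rfl⟩ : ∃ j, e = j + 1 := ⟨e - 1, by omega⟩
  have h3 := (H.restrict le_rfl (Nat.le_succ e)).sq_norm_le_pairing hμ hℓ h1 (by omega)
  have h5 := H.input_nonneg hℓ (by omega : s ≤ e) (by omega)
  have h6 : pairing g h s (e + 1) δ ω = pairing g h s e δ ω
      + (inner ℝ (g (e + 1)) (δ (e + 1)) + inner ℝ (h e) (ω e)) := by
    unfold pairing
    rw [Finset.sum_Ico_succ_top (by omega)]
  linarith

end GradientDifference

/-! ### Exponential decay of perturbations -/

theorem sq_sum_inner_le {V W : Type*} [NormedAddCommGroup V] [InnerProductSpace ℝ V]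
    [NormedAddCommGroup W] [InnerProductSpace ℝ W] {ι : Type*} (s : Finset ι) (x x' : ι → V)
    (y y' : ι → W) :
    (∑ i ∈ s, (inner ℝ (x i) (x' i) + inner ℝ (y i) (y' i))) ^ 2
      ≤ (∑ i ∈ s, (‖x i‖ ^ 2 + ‖y i‖ ^ 2)) * (∑ i ∈ s, (‖y' i‖ ^ 2 + ‖x' i‖ ^ 2)) := by
  have h1 : ∀ i, |inner ℝ (x i) (x' i) + inner ℝ (y i) (y' i)|
      ≤ √(‖x i‖ ^ 2 + ‖y i‖ ^ 2) * √(‖y' i‖ ^ 2 + ‖x' i‖ ^ 2) := fun i => by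
    rw [← Real.sqrt_mul (by positivity)]
    apply Real.le_sqrt_of_sq_le
    have h2 := abs_real_inner_le_norm (x i) (x' i)
    have h3 := abs_real_inner_le_norm (y i) (y' i)
    have h4 := (abs_add_le _ _).trans (add_le_add h2 h3)
    calc _ ≤ (‖x i‖ * ‖x' i‖ + ‖y i‖ * ‖y' i‖) ^ 2 := by gcongr
      _ ≤ _ := by nlinarith [sq_nonneg (‖x i‖ * ‖y' i‖ - ‖y i‖ * ‖x' i‖)]
  have h5 := (Finset.abs_sum_le_sum_abs _ s).trans (Finset.sum_le_sum fun i _ => h1 i)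
  calc _ = |∑ i ∈ s, (inner ℝ (x i) (x' i) + inner ℝ (y i) (y' i))| ^ 2 := (sq_abs _).symm
    _ ≤ (∑ i ∈ s, √(‖x i‖ ^ 2 + ‖y i‖ ^ 2) * √(‖y' i‖ ^ 2 + ‖x' i‖ ^ 2)) ^ 2 := by gcongr
    _ ≤ (∑ i ∈ s, √(‖x i‖ ^ 2 + ‖y i‖ ^ 2) ^ 2) * (∑ i ∈ s, √(‖y' i‖ ^ 2 + ‖x' i‖ ^ 2) ^ 2) :=
        Finset.sum_mul_sq_le_sq_mul_sq _ _ _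
    _ = _ := by
        congr 1 <;> exact Finset.sum_congr rfl fun i _ => Real.sq_sqrt (by positivity)

namespace GradientDifference

variable {μ ℓ L r : ℝ} {s e : ℕ} {δ g : ℕ → EuclideanSpace ℝ (Fin n)}
  {ω h : ℕ → EuclideanSpace ℝ (Fin m)}

/-- On a block long enough for steering, the difference of two stationary trajectories interacts
with the rest of the horizon through its two ends only.  The numbers `α` and `β` are the pairings
with the steering trajectories issued from the two ends; they behave like those of a rank-one
positive semidefinite form of norm at most `L`. -/
theorem exists_block (hS : S.UniformlyControllable d σ a b b') (hℓ : 0 < ℓ)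
    {p : ℕ} (hdp : d ≤ p) (hT : s + p ≤ S.T) (hL : ℓ * constC a b σ p ^ 2 ≤ L)
    (H : S.GradientDifference μ ℓ s (s + p) δ ω g h)
    (hst : S.FixedStationary g h s (s + p)) :
    ∃ α β : ℝ, S.Attains g h s (s + p) (δ s) 0 α ∧
      S.Attains g h s (s + p) 0 (δ (s + p)) (β + inner ℝ (g (s + p)) (δ (s + p))) ∧
      α + β = pairing g h s (s + p) δ ω - inner ℝ (g (s + p)) (δ (s + p)) ∧ 0 ≤ α + β ∧
      ∀ u v : ℝ, (u * α + v * β) ^ 2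
        ≤ L * (α + β) * (u ^ 2 * ‖δ s‖ ^ 2 + v ^ 2 * ‖δ (s + p)‖ ^ 2) := by
  obtain ⟨q, rfl⟩ : ∃ q, p = q + 1 := ⟨p - 1, by have := hS.d_pos; omega⟩
  obtain ⟨η, ν, hK⟩ := hS.exists_steering hdp hT
  -- The final state is not counted: `g` need not be cocoercive there, as the last state cost of the
  -- horizon need not be smooth.
  set g₀ : ℕ → EuclideanSpace ℝ (Fin n) := fun t => if t = s + (q + 1) then 0 else g t with hg₀
  have hsplit : ∀ (η : ℕ → EuclideanSpace ℝ (Fin n)) (ν : ℕ → EuclideanSpace ℝ (Fin m)),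
      pairing g h s (s + (q + 1)) η ν = pairing g₀ h s (s + (q + 1)) η ν
        + inner ℝ (g (s + (q + 1))) (η (s + (q + 1))) := fun η ν => by
    unfold pairing
    rw [← add_assoc, Finset.sum_Ico_succ_top (by omega), Finset.sum_Ico_succ_top (by omega)]
    have e1 : g₀ (s + q + 1) = 0 := by simp [hg₀, add_assoc]
    have e2 : ∑ t ∈ Finset.Ico s (s + q), (inner ℝ (g (t + 1)) (η (t + 1)) + inner ℝ (h t) (ν t))
        = ∑ t ∈ Finset.Ico s (s + q), (inner ℝ (g₀ (t + 1)) (η (t + 1)) + inner ℝ (h t) (ν t)) := by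
      refine Finset.sum_congr rfl fun t ht => ?_
      rw [Finset.mem_Ico] at ht
      simp only [hg₀]
      rw [if_neg (by omega)]
    rw [e1, e2, inner_zero_left]
    ring
  -- The pairing without the final state, on the steering trajectory with given end points.
  set P : EuclideanSpace ℝ (Fin n) × EuclideanSpace ℝ (Fin n) → ℝ :=
    fun w => pairing g₀ h s (s + (q + 1)) (fun t => η t w) (fun t => ν t w) with hP
  have hPlin : ∀ u v : ℝ, ∀ x z, P (u • x, v • z) = u * P (x, 0) + v * P (0, z) := by
    intro u v x z
    have e1 : (u • x, v • z) = u • ((x, 0) : EuclideanSpace ℝ (Fin n) × EuclideanSpace ℝ (Fin n))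
        + v • (0, z) := by simp
    have e2 : (fun t => η t (u • x, v • z))
        = u • (fun t => η t (x, 0)) + v • (fun t => η t (0, z)) := by
      funext t; rw [e1, map_add, map_smul, map_smul]; rfl
    have e3 : (fun t => ν t (u • x, v • z))
        = u • (fun t => ν t (x, 0)) + v • (fun t => ν t (0, z)) := by
      funext t; rw [e1, map_add, map_smul, map_smul]; rfl
    simp only [hP]
    rw [e2, e3, pairing_add, pairing_smul, pairing_smul]
  have hPatt : ∀ w, S.Attains g h s (s + (q + 1)) w.1 w.2
      (P w + inner ℝ (g (s + (q + 1))) w.2) := fun w => by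
    obtain ⟨k1, k2, k3, -⟩ := hK w
    refine ⟨_, _, k1, k2, k3, ?_⟩
    rw [hsplit, k3]
  have hPδ : P (δ s, δ (s + (q + 1))) = pairing g₀ h s (s + (q + 1)) δ ω := by
    have h1 := (hPatt (δ s, δ (s + (q + 1)))).add (H.attains.smul (-1))
    simp only [neg_smul, one_smul, add_neg_cancel] at h1
    have h2 := hst _ h1
    rw [hsplit δ ω] at h2
    linarith
  have hαβ : P (δ s, 0) + P (0, δ (s + (q + 1))) = pairing g₀ h s (s + (q + 1)) δ ω := by
    rw [← hPδ]
    have := hPlin 1 1 (δ s) (δ (s + (q + 1)))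
    simp only [one_smul, one_mul] at this
    exact this.symm
  have hG : ∑ t ∈ Finset.Ico s (s + (q + 1)), (‖g₀ (t + 1)‖ ^ 2 + ‖h t‖ ^ 2)
      ≤ ℓ * pairing g₀ h s (s + (q + 1)) δ ω := by
    unfold pairing
    rw [Finset.mul_sum]
    refine Finset.sum_le_sum fun t ht => ?_
    rw [Finset.mem_Ico] at ht
    rw [mul_add]
    refine add_le_add ?_ (H.coco_input t ht.1 ht.2)
    by_cases h1 : t + 1 = s + (q + 1)
    · simp [hg₀, h1]
    · simp only [hg₀, if_neg h1]
      exact H.coco_state (t + 1) (by omega) (by omega)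
  have hnn : 0 ≤ pairing g₀ h s (s + (q + 1)) δ ω :=
    nonneg_of_mul_nonneg_right (le_trans (Finset.sum_nonneg fun t _ => by positivity) hG) hℓ
  refine ⟨P (δ s, 0), P (0, δ (s + (q + 1))), ?_, ?_, ?_, ?_, fun u v => ?_⟩
  · simpa using hPatt (δ s, 0)
  · exact hPatt (0, δ (s + (q + 1)))
  · rw [hαβ, hsplit δ ω]; ring
  · rw [hαβ]; exact hnn
  · rw [← hPlin, hαβ]
    have h1 := (hK (u • δ s, v • δ (s + (q + 1)))).2.2.2
    have h2 : ∑ t ∈ Finset.Ico s (s + (q + 1)),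
        (‖ν t (u • δ s, v • δ (s + (q + 1)))‖ ^ 2
          + ‖η (t + 1) (u • δ s, v • δ (s + (q + 1)))‖ ^ 2)
        ≤ constC a b σ (q + 1) ^ 2 * (u ^ 2 * ‖δ s‖ ^ 2 + v ^ 2 * ‖δ (s + (q + 1))‖ ^ 2) := by
      rw [Finset.sum_Ico_eq_sum_range, add_tsub_cancel_left, Finset.sum_add_distrib]
      refine h1.trans (le_of_eq ?_)
      simp only [norm_smul, mul_pow, Real.norm_eq_abs, sq_abs]
    calc _ ≤ _ := sq_sum_inner_le _ _ _ _ _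
      _ ≤ (ℓ * pairing g₀ h s (s + (q + 1)) δ ω) * (constC a b σ (q + 1) ^ 2
            * (u ^ 2 * ‖δ s‖ ^ 2 + v ^ 2 * ‖δ (s + (q + 1))‖ ^ 2)) :=
          mul_le_mul hG h2 (Finset.sum_nonneg fun t _ => by positivity) (by positivity)
      _ = (ℓ * constC a b σ (q + 1) ^ 2) * pairing g₀ h s (s + (q + 1)) δ ω
            * (u ^ 2 * ‖δ s‖ ^ 2 + v ^ 2 * ‖δ (s + (q + 1))‖ ^ 2) := by ring
      _ ≤ _ := by gcongr

/-- A test perturbation that ends at the actual difference and is damped by `r²` on each earlier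
block.  Each damped block costs no more than the monotonicity at its two ends provides. -/
theorem exists_forward_test (hS : S.UniformlyControllable d σ a b b') (hℓ : 0 < ℓ) (hμ : 0 ≤ μ)
    (hL0 : 0 ≤ L) (hL : ∀ p, d ≤ p → p ≤ 2 * d - 1 → ℓ * constC a b σ p ^ 2 ≤ L)
    (hr : 0 < r) (hcrit : (1 - r) ^ 2 * L ≤ 2 * r * μ) (p : ℕ) :
    d ≤ p → s + p ≤ S.T → S.GradientDifference μ ℓ s (s + p) δ ω g h →
    S.FixedStationary g h s (s + p) →
    ∃ N, 1 ≤ N ∧ p ≤ N * (2 * d - 1) ∧ ∃ v, S.Attains g h s (s + p) 0 (δ (s + p)) v ∧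
      μ / 2 * ‖δ (s + p)‖ ^ 2 - (r ^ 2) ^ (N - 1) * (L / 4 * ‖δ s‖ ^ 2) ≤ v := by
  have hd := hS.d_pos
  induction p using Nat.strong_induction_on with
  | _ p ih =>
    intro hdp hT H hst
    have hnode := H.mono (s + p) (by omega) le_rfl
    have hμ' : 0 ≤ μ / 2 * ‖δ (s + p)‖ ^ 2 := by positivity
    by_cases hp : p ≤ 2 * d - 1
    · obtain ⟨α, β, -, h2, -, h4, h5⟩ := H.exists_block hS hℓ hdp hT (hL p hdp hp) hst
      refine ⟨1, le_rfl, by omega, _, h2, ?_⟩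
      have h6 := end_le (α := β) (β := α) (Y := ‖δ s‖ ^ 2) (X := ‖δ (s + p)‖ ^ 2) (L := L)
        (by linarith) (fun u v => by
          have := h5 v u
          rw [add_comm (u * β), add_comm β, add_comm (u ^ 2 * _)]; exact this) hL0 (by positivity)
      simp only [Nat.sub_self, pow_zero, one_mul]
      linarith
    · obtain ⟨q, rfl⟩ := Nat.exists_eq_add_of_le' hdp
      obtain ⟨N, hN, hqN, v, hv, hv'⟩ := ih q (by omega) (by omega) (by omega)
        (H.restrict le_rfl (by omega)) (hst.mono le_rfl (by omega) (by omega))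
      rw [← add_assoc] at hT H hst hnode hμ' ⊢
      obtain ⟨α, β, h1, h2, -, h4, h5⟩ := (H.restrict (by omega : s ≤ s + q) le_rfl).exists_block hS
        hℓ le_rfl hT (hL d le_rfl (by omega)) (hst.mono (by omega) (by omega) le_rfl)
      have h6 := weighted_le hμ hr hcrit h4 (by positivity) (by positivity) h5
      refine ⟨N + 1, by omega, ?_, r ^ 2 * v
        + (r ^ 2 * α + (β + inner ℝ (g (s + q + d)) (δ (s + q + d)))), ?_, ?_⟩
      · rw [add_mul]; omega
      · have h7 := hv.smul (r ^ 2)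
        have h8 := (h1.smul (r ^ 2)).add h2
        simp only [smul_zero, zero_add, add_zero] at h7 h8
        exact h7.trans (by omega) (by omega) h8
      · have h9 := mul_le_mul_of_nonneg_left hv' (sq_nonneg r)
        have e1 : (r ^ 2) ^ (N + 1 - 1) = r ^ 2 * (r ^ 2) ^ (N - 1) := by
          rw [← pow_succ']; congr 1; omega
        rw [e1]
        nlinarith

/-- The mirror image of `exists_forward_test`: the perturbation starts at the actual difference and
is damped by `r²` on each later block. -/
theorem exists_backward_test (hS : S.UniformlyControllable d σ a b b') (hℓ : 0 < ℓ) (hμ : 0 ≤ μ)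
    (hL0 : 0 ≤ L) (hL : ∀ p, d ≤ p → p ≤ 2 * d - 1 → ℓ * constC a b σ p ^ 2 ≤ L)
    (hr : 0 < r) (hcrit : (1 - r) ^ 2 * L ≤ 2 * r * μ) (p : ℕ) :
    ∀ s, d ≤ p → s + p ≤ S.T → S.GradientDifference μ ℓ s (s + p) δ ω g h →
    S.FixedStationary g h s (s + p) →
    ∃ N, 1 ≤ N ∧ p ≤ N * (2 * d - 1) ∧ ∃ v, S.Attains g h s (s + p) (δ s) 0 v ∧
      -(μ / 2) * ‖δ s‖ ^ 2 - (r ^ 2) ^ (N - 1) * (L / 4 * ‖δ (s + p)‖ ^ 2) ≤ v := by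
  have hd := hS.d_pos
  induction p using Nat.strong_induction_on with
  | _ p ih =>
    intro s hdp hT H hst
    have hμ' : 0 ≤ μ / 2 * ‖δ s‖ ^ 2 := by positivity
    by_cases hp : p ≤ 2 * d - 1
    · obtain ⟨α, β, h1, -, -, h4, h5⟩ := H.exists_block hS hℓ hdp hT (hL p hdp hp) hst
      refine ⟨1, le_rfl, by omega, _, h1, ?_⟩
      have h6 := end_le h4 h5 hL0 (by positivity)
      simp only [Nat.sub_self, pow_zero, one_mul]
      linarith
    · obtain ⟨q, rfl⟩ := Nat.exists_eq_add_of_le hdp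
      rw [← add_assoc] at hT H hst ⊢
      obtain ⟨N, hN, hqN, v, hv, hv'⟩ := ih q (by omega) (s + d) (by omega) hT
        (H.restrict (by omega) le_rfl) (hst.mono (by omega) (by omega) le_rfl)
      have hnode := H.mono (s + d) (by omega) (by omega)
      obtain ⟨α, β, h1, h2, -, h4, h5⟩ := (H.restrict le_rfl (by omega : s + d ≤ s + d + q)).exists_block
        hS hℓ le_rfl (by omega) (hL d le_rfl (by omega)) (hst.mono le_rfl (by omega) (by omega))
      have h6 := weighted_le (α := β) (β := α) (Y := ‖δ s‖ ^ 2) (X := ‖δ (s + d)‖ ^ 2) (L := L)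
        hμ hr hcrit (by linarith) (by positivity) (by positivity) (fun u v => by
          have := h5 v u
          rw [add_comm (u * β), add_comm β, add_comm (u ^ 2 * _)]; exact this)
      refine ⟨N + 1, by omega, ?_, (α + r ^ 2 * (β + inner ℝ (g (s + d)) (δ (s + d))))
        + r ^ 2 * v, ?_, ?_⟩
      · rw [add_mul]; omega
      · have h7 := hv.smul (r ^ 2)
        have h8 := h1.add (h2.smul (r ^ 2))
        simp only [smul_zero, zero_add, add_zero] at h7 h8
        exact h8.trans (by omega) (by omega) h7
      · have h9 := mul_le_mul_of_nonneg_left hv' (sq_nonneg r)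
        have h10 := mul_le_mul_of_nonneg_left hnode (sq_nonneg r)
        have e1 : (r ^ 2) ^ (N + 1 - 1) = r ^ 2 * (r ^ 2) ^ (N - 1) := by
          rw [← pow_succ']; congr 1; omega
        rw [e1]
        nlinarith

/-- Two stationary trajectories with free end point: the difference of their initial states is
forgotten exponentially fast. -/
theorem exists_decay_of_free (hS : S.UniformlyControllable d σ a b b') (hℓ : 0 < ℓ) (hμ : 0 ≤ μ)
    (hμL : μ ≤ L) (hL : ∀ p, d ≤ p → p ≤ 2 * d - 1 → ℓ * constC a b σ p ^ 2 ≤ L)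
    (hr : 0 < r) (hcrit : (1 - r) ^ 2 * L ≤ 2 * r * μ)
    (H : S.GradientDifference μ ℓ s e δ ω g h) (hst : S.FreeStationary g h s e)
    (hT : e ≤ S.T) (hde : s + d ≤ e) {p : ℕ} (hp : s + p ≤ e) :
    ∃ N, 1 ≤ N ∧ p ≤ N * (2 * d - 1) ∧
      μ * ‖δ (s + p)‖ ^ 2 ≤ (r ^ 2) ^ (N - 1) * (L * ‖δ s‖ ^ 2) := by
  have hd := hS.d_pos
  have hL0 := hμ.trans hμL
  by_cases hdp : d ≤ p
  · obtain ⟨N, hN, hN', v, hv, hv'⟩ := exists_forward_test hS hℓ hμ hL0 hL hr hcrit p hdp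
      (by omega) (H.restrict le_rfl hp) (hst.fixedStationary.mono le_rfl (by omega) hp)
    refine ⟨N, hN, hN', ?_⟩
    have H' := H.restrict (by omega : s ≤ s + p) le_rfl
    have h1 := hst _ _ (hv.trans (by omega) hp H'.attains)
    have h2 := H'.pairing_nonneg hμ hℓ
    have h3 : 0 ≤ (r ^ 2) ^ (N - 1) * (L * ‖δ s‖ ^ 2) := by positivity
    nlinarith
  · refine ⟨1, le_rfl, by omega, ?_⟩
    simp only [Nat.sub_self, pow_zero, one_mul]
    rcases Nat.eq_zero_or_pos p with rfl | hp0
    · rw [add_zero]; gcongr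
    · have H1 := H.restrict (s' := s) (e' := s + d) le_rfl hde
      have H2 := H.restrict (s' := s + d) (e' := e) (by omega) le_rfl
      obtain ⟨α, β, h1, h2, h3, h4, h5⟩ := H1.exists_block hS hℓ le_rfl (by omega)
        (hL d le_rfl (by omega)) (hst.fixedStationary.mono le_rfl (by omega) hde)
      have h6 := hst _ _ (h2.trans (by omega) hde H2.attains)
      have h7 := H2.pairing_nonneg hμ hℓ
      have h8 := H1.mono (s + d) (by omega) le_rfl
      have h9 := H1.sq_norm_add_le_pairing hμ hℓ (t := s + p) (by omega) (by omega)
      have h10 : 0 ≤ μ * ‖δ (s + d)‖ ^ 2 := by positivity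
      have h11 := h5 1 0
      have h12 : α + β ≤ α := by linarith
      have h13 : 0 ≤ α := h4.trans h12
      have h14 : α ≤ L * ‖δ s‖ ^ 2 := by
        rcases h13.eq_or_lt with h0 | h0
        · rw [← h0]; positivity
        · have : α * α ≤ α * (L * ‖δ s‖ ^ 2) := by
            have : L * (α + β) * ‖δ s‖ ^ 2 ≤ L * α * ‖δ s‖ ^ 2 := by gcongr
            nlinarith
          exact le_of_mul_le_mul_left this h0
      linarith

/-- Two stationary trajectories with the same initial state and prescribed final states: the
difference of the final states has an exponentially small effect on the first step. -/
theorem exists_decay_of_fixed (hS : S.UniformlyControllable d σ a b b') (hℓ : 0 < ℓ) (hμ : 0 ≤ μ)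
    (hμL : μ ≤ L) (hL : ∀ p, d ≤ p → p ≤ 2 * d - 1 → ℓ * constC a b σ p ^ 2 ≤ L)
    (hr : 0 < r) (hcrit : (1 - r) ^ 2 * L ≤ 2 * r * μ) {p : ℕ}
    (H : S.GradientDifference μ ℓ s (s + (p + 1)) δ ω g h)
    (hst : S.FixedStationary g h s (s + (p + 1))) (h0 : δ s = 0)
    (hT : s + (p + 1) ≤ S.T) (hdp : d ≤ p + 1) :
    ∃ N, 1 ≤ N ∧ p ≤ N * (2 * d - 1) ∧
      μ * ‖δ (s + 1)‖ ^ 2 ≤ (r ^ 2) ^ (N - 1) * (L * ‖δ (s + (p + 1))‖ ^ 2) := by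
  have hd := hS.d_pos
  have hL0 := hμ.trans hμL
  by_cases hdp' : d ≤ p
  · have e1 : s + (p + 1) = s + 1 + p := by omega
    rw [e1] at H hst hT ⊢
    obtain ⟨N, hN, hN', v, hv, hv'⟩ := exists_backward_test hS hℓ hμ hL0 hL hr hcrit p (s + 1) hdp'
      (by omega) (H.restrict (by omega) le_rfl) (hst.mono (by omega) (by omega) le_rfl)
    refine ⟨N, hN, hN', ?_⟩
    have H' := H.restrict (s' := s) (e' := s + 1) le_rfl (by omega)
    have h1 := H'.attains
    rw [h0] at h1
    have h2 := hst _ (h1.trans (by omega) (by omega) hv)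
    have h3 := H'.sq_norm_le_pairing hμ hℓ (t := s + 1) (by omega) le_rfl
    have h4 : 0 ≤ (r ^ 2) ^ (N - 1) * (L * ‖δ (s + 1 + p)‖ ^ 2) := by positivity
    nlinarith
  · refine ⟨1, le_rfl, by omega, ?_⟩
    simp only [Nat.sub_self, pow_zero, one_mul]
    rcases Nat.eq_zero_or_pos p with rfl | hp0
    · rw [zero_add]; gcongr
    · obtain ⟨α, β, -, -, h3, h4, h5⟩ := H.exists_block hS hℓ hdp hT
        (hL _ hdp (by omega)) hst
      have h9 := H.sq_norm_add_le_pairing hμ hℓ (t := s + 1) (by omega) (by omega)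
      have h11 := h5 1 1
      rw [h0] at h11
      simp only [one_mul, one_pow, norm_zero, ne_eq, OfNat.ofNat_ne_zero, not_false_eq_true,
        zero_pow, zero_add] at h11
      have h14 : α + β ≤ L * ‖δ (s + (p + 1))‖ ^ 2 := by
        rcases h4.eq_or_lt with h0 | h0
        · rw [← h0]; positivity
        · have : (α + β) * (α + β) ≤ (α + β) * (L * ‖δ (s + (p + 1))‖ ^ 2) := by
            nlinarith
          exact le_of_mul_le_mul_left this h0
      linarith

end GradientDifference

variable {mf ℓf mc ℓc : ℝ}

/-! ### Optimal trajectories: existence -/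

theorem stepsCost_eq_sum_range (t p : ℕ) (y : ℕ → EuclideanSpace ℝ (Fin n))
    (v : ℕ → EuclideanSpace ℝ (Fin m)) :
    S.stepsCost t p y v
      = ∑ τ ∈ Finset.range p, (S.f (t + τ + 1) (y (τ + 1)) + S.c (t + τ + 1) (v τ)) := by
  unfold stepsCost
  rw [← Finset.Ico_add_one_right_eq_Icc, Finset.sum_Ico_eq_sum_range]
  refine Finset.sum_congr (by simp) fun τ _ => ?_
  simp [add_assoc, add_comm 1 τ]

theorem isOptimal_zero_iff {t p : ℕ} {x : EuclideanSpace ℝ (Fin n)}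
    {ζ y : ℕ → EuclideanSpace ℝ (Fin n)} {v : ℕ → EuclideanSpace ℝ (Fin m)} :
    S.IsOptimal t p x ζ (fun _ => 0) y v ↔ S.IsTrajectory t p x ζ y v ∧
      ∀ y' v', S.IsTrajectory t p x ζ y' v' → S.stepsCost t p y v ≤ S.stepsCost t p y' v' := by
  simp [IsOptimal]

theorem isOptimal_originIndicator_iff {t p : ℕ} {x : EuclideanSpace ℝ (Fin n)}
    {ζ y : ℕ → EuclideanSpace ℝ (Fin n)} {v : ℕ → EuclideanSpace ℝ (Fin m)}
    (hfeas : ∃ y v, S.IsTrajectory t p x ζ y v ∧ y p = 0) :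
    S.IsOptimal t p x ζ originIndicator y v ↔ (S.IsTrajectory t p x ζ y v ∧ y p = 0) ∧
      ∀ y' v', S.IsTrajectory t p x ζ y' v' → y' p = 0 →
        S.stepsCost t p y v ≤ S.stepsCost t p y' v' := by
  constructor
  · rintro ⟨h1, h2⟩
    have h3 : y p = 0 := by
      obtain ⟨y₀, v₀, h4, h5⟩ := hfeas
      have h6 := h2 y₀ v₀ h4
      by_contra h7
      rw [originIndicator, originIndicator, if_neg h7, if_pos h5, add_zero,
        EReal.coe_add_top, top_le_iff] at h6
      exact EReal.coe_ne_top _ h6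
    refine ⟨⟨h1, h3⟩, fun y' v' h4 h5 => ?_⟩
    have h6 := h2 y' v' h4
    rw [originIndicator, originIndicator, if_pos h3, if_pos h5, add_zero, add_zero] at h6
    exact_mod_cast h6
  · rintro ⟨⟨h1, h3⟩, h2⟩
    refine ⟨h1, fun y' v' h4 => ?_⟩
    rw [originIndicator, originIndicator, if_pos h3, add_zero]
    by_cases h5 : y' p = 0
    · rw [if_pos h5, add_zero]
      exact_mod_cast h2 y' v' h4 h5
    · rw [if_neg h5, EReal.coe_add_top]
      exact le_top

/-- The states reached from `x` under the inputs `v`. -/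
def rollout (S : LTVProblem n m) (t : ℕ) (x : EuclideanSpace ℝ (Fin n))
    (ζ : ℕ → EuclideanSpace ℝ (Fin n)) (v : ℕ → EuclideanSpace ℝ (Fin m)) :
    ℕ → EuclideanSpace ℝ (Fin n)
  | 0 => x
  | j + 1 => S.A (t + j) (S.rollout t x ζ v j) + S.B (t + j) (v j) + ζ j

theorem isTrajectory_rollout (t p : ℕ) (x : EuclideanSpace ℝ (Fin n))
    (ζ : ℕ → EuclideanSpace ℝ (Fin n)) (v : ℕ → EuclideanSpace ℝ (Fin m)) :
    S.IsTrajectory t p x ζ (S.rollout t x ζ v) v :=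
  ⟨rfl, fun _ _ => rfl⟩

theorem IsTrajectory.eq_of_input_eq {t p : ℕ} {x : EuclideanSpace ℝ (Fin n)}
    {ζ y y' : ℕ → EuclideanSpace ℝ (Fin n)} {v v' : ℕ → EuclideanSpace ℝ (Fin m)}
    (h : S.IsTrajectory t p x ζ y v) (h' : S.IsTrajectory t p x ζ y' v')
    (hv : ∀ j, j < p → v j = v' j) (j : ℕ) (hj : j ≤ p) : y j = y' j := by
  induction j with
  | zero => rw [h.1, h'.1]
  | succ j ih => rw [h.2 j hj, h'.2 j hj, ih (by omega), hv j hj]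

theorem stepsCost_congr {t p : ℕ} {y y' : ℕ → EuclideanSpace ℝ (Fin n)}
    {v v' : ℕ → EuclideanSpace ℝ (Fin m)} (hy : ∀ j, j ≤ p → y j = y' j)
    (hv : ∀ j, j < p → v j = v' j) : S.stepsCost t p y v = S.stepsCost t p y' v' := by
  rw [stepsCost_eq_sum_range, stepsCost_eq_sum_range]
  refine Finset.sum_congr rfl fun τ hτ => ?_
  have := Finset.mem_range.1 hτ
  rw [hy (τ + 1) this, hv τ this]

theorem WellConditioned.stage_nonneg (h : S.WellConditioned mf ℓf mc ℓc) {t : ℕ} (ht : t < S.T)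
    (x : EuclideanSpace ℝ (Fin n)) (u : EuclideanSpace ℝ (Fin m)) :
    0 ≤ S.f (t + 1) x + S.c (t + 1) u :=
  add_nonneg (h.f_nonneg _ (by omega) ht _) (h.c_nonneg _ (by omega) ht _)

theorem continuous_rollout (t : ℕ) (x : EuclideanSpace ℝ (Fin n))
    (ζ : ℕ → EuclideanSpace ℝ (Fin n)) (j : ℕ) :
    Continuous fun v : ℕ → EuclideanSpace ℝ (Fin m) => S.rollout t x ζ v j := by
  induction j with
  | zero => exact continuous_const
  | succ j ih =>
    exact (((S.A (t + j)).continuous.comp ih).add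
      ((S.B (t + j)).continuous.comp (continuous_apply j))).add continuous_const

/-- A feasible problem with a closed set of final states has a minimizer, by coercivity of the
input costs. -/
theorem WellConditioned.exists_minimizer (h : S.WellConditioned mf ℓf mc ℓc) {t p : ℕ}
    (hT : t + p ≤ S.T) {x : EuclideanSpace ℝ (Fin n)} {ζ : ℕ → EuclideanSpace ℝ (Fin n)}
    {Z : Set (EuclideanSpace ℝ (Fin n))} (hZ : IsClosed Z)
    (hfeas : ∃ y v, S.IsTrajectory t p x ζ y v ∧ y p ∈ Z) :
    ∃ y v, (S.IsTrajectory t p x ζ y v ∧ y p ∈ Z) ∧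
      ∀ y' v', S.IsTrajectory t p x ζ y' v' → y' p ∈ Z →
        S.stepsCost t p y v ≤ S.stepsCost t p y' v' := by
  set ext : (Fin p → EuclideanSpace ℝ (Fin m)) → ℕ → EuclideanSpace ℝ (Fin m) :=
    fun v j => if hj : j < p then v ⟨j, hj⟩ else 0 with hext
  have hext_c : Continuous ext := by
    refine continuous_pi fun j => ?_
    by_cases hj : j < p
    · simp only [hext, dif_pos hj]; exact continuous_apply _
    · simp only [hext, dif_neg hj]; exact continuous_const
  have hext_r : ∀ v : ℕ → EuclideanSpace ℝ (Fin m), ∀ j, j < p →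
      v j = ext (fun i => v i) j := fun v j hj => by simp [hext, hj]
  set J : (Fin p → EuclideanSpace ℝ (Fin m)) → ℝ :=
    fun v => S.stepsCost t p (S.rollout t x ζ (ext v)) (ext v) with hJ
  have hJc : Continuous J := by
    simp only [hJ, stepsCost_eq_sum_range]
    refine continuous_finsetSum _ fun τ hτ => ?_
    have := Finset.mem_range.1 hτ
    exact ((h.f_contDiff _ (by omega) (by omega)).continuous.comp
      ((continuous_rollout t x ζ (τ + 1)).comp hext_c)).add
      ((h.c_contDiff _ (by omega) (by omega)).continuous.comp
        ((continuous_apply τ).comp hext_c))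
  have hJr : ∀ y v, S.IsTrajectory t p x ζ y v →
      S.stepsCost t p y v = J (fun i => v i) ∧ y p = S.rollout t x ζ (ext fun i => v i) p :=
    fun y v hyv => by
      have h1 := hyv.eq_of_input_eq (isTrajectory_rollout t p x ζ _) (hext_r v)
      exact ⟨stepsCost_congr h1 (hext_r v), h1 p le_rfl⟩
  obtain ⟨y₀, v₀, h₀, hz₀⟩ := hfeas
  set K := {v | S.rollout t x ζ (ext v) p ∈ Z} ∩ {v | J v ≤ J fun i => v₀ i} with hK
  have hKc : IsClosed K :=
    (hZ.preimage ((continuous_rollout t x ζ p).comp hext_c)).inter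
      (isClosed_le hJc continuous_const)
  have hKb : Bornology.IsBounded K := by
    rw [isBounded_iff_forall_norm_le]
    refine ⟨√(2 / mc * J fun i => v₀ i), fun v hv => ?_⟩
    rw [pi_norm_le_iff_of_nonneg (Real.sqrt_nonneg _)]
    intro i
    apply Real.le_sqrt_of_sq_le
    have h1 : mc / 2 * ‖v i‖ ^ 2 ≤ J v := by
      have h2 := (h.c_convex (t + i + 1) (by omega) (by omega)).sq_norm_le
        (h.c_nonneg _ (by omega) (by omega)) (h.c_zero _ (by omega) (by omega)) (v i)
      refine h2.trans ?_
      have h3 := Finset.single_le_sum (s := Finset.range p)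
        (f := fun τ => S.f (t + τ + 1) (S.rollout t x ζ (ext v) (τ + 1))
          + S.c (t + τ + 1) (ext v τ))
        (fun τ hτ => h.stage_nonneg (by have := Finset.mem_range.1 hτ; omega) _ _)
        (Finset.mem_range.2 i.2)
      simp only [hJ, stepsCost_eq_sum_range]
      refine le_trans ?_ h3
      have h4 : ext v i = v i := by simp [hext]
      rw [h4]
      exact le_add_of_nonneg_left (h.f_nonneg _ (by omega) (by omega) _)
    have h5 := h1.trans hv.2
    have := h.mc_pos
    rw [div_mul_eq_mul_div, le_div_iff₀ this]
    linarith
  have hne : K.Nonempty := ⟨fun i => v₀ i, by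
    refine ⟨?_, le_refl (J fun i => v₀ i)⟩
    rw [Set.mem_ofPred_eq, ← (hJr y₀ v₀ h₀).2]
    exact hz₀⟩
  obtain ⟨v, hv, hmin⟩ := (Metric.isCompact_of_isClosed_isBounded hKc hKb).exists_isMinOn hne
    hJc.continuousOn
  refine ⟨_, _, ⟨isTrajectory_rollout t p x ζ (ext v), hv.1⟩, fun y' v' h1 h2 => ?_⟩
  obtain ⟨h3, h4⟩ := hJr y' v' h1
  rw [h3]
  by_cases h5 : J (fun i => v' i) ≤ J fun i => v₀ i
  · exact hmin (show (fun i : Fin p => v' i) ∈ K from ⟨by rw [Set.mem_ofPred_eq, ← h4]; exact h2, h5⟩)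
  · exact hv.2.trans (not_le.1 h5).le

theorem WellConditioned.exists_isOptimal_zero (h : S.WellConditioned mf ℓf mc ℓc) {t p : ℕ}
    (hT : t + p ≤ S.T) (x : EuclideanSpace ℝ (Fin n)) (ζ : ℕ → EuclideanSpace ℝ (Fin n)) :
    ∃ y v, S.IsOptimal t p x ζ (fun _ => 0) y v := by
  obtain ⟨y, v, h1, h2⟩ := h.exists_minimizer hT (x := x) (ζ := ζ) isClosed_univ
    ⟨_, _, isTrajectory_rollout t p x ζ 0, trivial⟩
  exact ⟨y, v, isOptimal_zero_iff.2 ⟨h1.1, fun y' v' h3 => h2 y' v' h3 trivial⟩⟩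

theorem IsTrajectory.add_homogeneous {t p : ℕ} {x : EuclideanSpace ℝ (Fin n)}
    {ζ y η : ℕ → EuclideanSpace ℝ (Fin n)} {v ν : ℕ → EuclideanSpace ℝ (Fin m)}
    (h : S.IsTrajectory t p x ζ y v) (h' : S.Homogeneous t (t + p) η ν) :
    S.IsTrajectory t p (x + η t) ζ (fun j => y j + η (t + j)) (fun j => v j + ν (t + j)) := by
  refine ⟨by simp [h.1], fun j hj => ?_⟩
  have := h' (t + j) (by omega) (by omega)
  simp only [← add_assoc, h.2 j hj, this, map_add]
  abel

theorem UniformlyControllable.exists_feasible (h : S.UniformlyControllable d σ a b b') {t p : ℕ}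
    (hdp : d ≤ p) (hT : t + p ≤ S.T) (x : EuclideanSpace ℝ (Fin n))
    (ζ : ℕ → EuclideanSpace ℝ (Fin n)) : ∃ y v, S.IsTrajectory t p x ζ y v ∧ y p = 0 := by
  obtain ⟨η, ν, hK⟩ := h.exists_steering hdp hT
  obtain ⟨h1, h2, h3, -⟩ := hK (0, -S.rollout t x ζ 0 p)
  have h4 := (isTrajectory_rollout t p x ζ 0).add_homogeneous h1
  simp only [h2, add_zero] at h4
  refine ⟨_, _, h4, ?_⟩
  simp [h3]

theorem exists_isOptimal_originIndicator (h : S.WellConditioned mf ℓf mc ℓc)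
    (hS : S.UniformlyControllable d σ a b b') {t p : ℕ} (hdp : d ≤ p) (hT : t + p ≤ S.T)
    (x : EuclideanSpace ℝ (Fin n)) (ζ : ℕ → EuclideanSpace ℝ (Fin n)) :
    ∃ y v, S.IsOptimal t p x ζ originIndicator y v := by
  have hf := hS.exists_feasible hdp hT x ζ
  obtain ⟨y, v, h1, h2⟩ := h.exists_minimizer hT (x := x) (ζ := ζ) (isClosed_singleton (x := 0)) hf
  exact ⟨y, v, (isOptimal_originIndicator_iff hf).2 ⟨h1, h2⟩⟩

/-- A run is built by applying, at each state reached, the first input of a chosen optimal plan, and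
then the whole final plan. -/
theorem exists_isPredictiveControl (h : S.WellConditioned mf ℓf mc ℓc)
    (hS : S.UniformlyControllable d σ a b b') {k : ℕ} (hdk : d ≤ k) (hkT : k ≤ S.T) :
    ∃ x u, S.IsPredictiveControl k originIndicator x u := by
  have hex : ∀ (t : ℕ) (x : EuclideanSpace ℝ (Fin n)), ∃ u₀ : EuclideanSpace ℝ (Fin m),
      t + k < S.T → ∃ y v, S.IsOptimal t k x (fun τ => S.w (t + τ)) originIndicator y v ∧
        u₀ = v 0 := fun t x => by
    by_cases ht : t + k < S.T
    · obtain ⟨y, v, hyv⟩ := exists_isOptimal_originIndicator h hS hdk ht.le x (fun τ => S.w (t + τ))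
      exact ⟨v 0, fun _ => ⟨y, v, hyv, rfl⟩⟩
    · exact ⟨0, fun h => absurd h ht⟩
  choose π hπ using hex
  let X : ℕ → EuclideanSpace ℝ (Fin n) := fun t =>
    Nat.rec S.x0 (fun t x => S.A t x + S.B t (π t x) + S.w t) t
  have hX : ∀ t, X (t + 1) = S.A t (X t) + S.B t (π t (X t)) + S.w t := fun t => rfl
  obtain ⟨N, hN⟩ := Nat.exists_eq_add_of_le' hkT
  obtain ⟨y, v, hyv⟩ := h.exists_isOptimal_zero (t := N) (p := k) hN.ge (X N)
    (fun τ => S.w (N + τ))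
  have hTk : S.T - k = N := by omega
  refine ⟨fun t => if t ≤ N then X t else y (t - N), fun t => if t < N then π t (X t) else v (t - N),
    ⟨?_, fun t _ => ?_⟩, fun t ht => ?_, ?_⟩
  · simp [X]
  · rcases lt_trichotomy t N with h1 | h1 | h1
    · simp only [zero_add, h1, h1.le, if_true, Nat.succ_le_of_lt h1]
      exact hX t
    · subst h1
      have := hyv.1.2 0 (by omega)
      rw [hyv.1.1] at this
      simpa using this
    · obtain ⟨j, rfl⟩ := Nat.exists_eq_add_of_lt h1
      have := hyv.1.2 (j + 1) (by omega)
      have e1 : N + j + 1 + 1 - N = j + 1 + 1 := by omega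
      have e2 : N + j + 1 - N = j + 1 := by omega
      dsimp only
      rw [if_neg (by omega), if_neg (by omega), if_neg (by omega), e1, e2, this]
      simp only [zero_add, add_assoc]
  · obtain ⟨y', v', h1, h2⟩ := hπ t (X t) ht
    refine ⟨y', v', ?_, ?_⟩
    · dsimp only; rw [if_pos (by omega)]; exact h1
    · dsimp only; rw [if_pos (by omega)]; exact h2
  · rw [hTk]
    refine ⟨y, v, ?_, fun τ _ => ?_⟩
    · simpa using hyv
    · simp

theorem optCost_eq {x : ℕ → EuclideanSpace ℝ (Fin n)} {u : ℕ → EuclideanSpace ℝ (Fin m)}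
    (h : S.IsOptimal 0 S.T S.x0 S.w (fun _ => 0) x u) : S.optCost = S.cost x u := by
  rw [isOptimal_zero_iff] at h
  refine IsLeast.csInf_eq ⟨⟨x, u, h.1, rfl⟩, ?_⟩
  rintro _ ⟨x', u', h1, rfl⟩
  exact h.2 x' u' h1

/-! ### Optimal trajectories: first-order conditions -/

/-- `(x, u)` obeys the dynamics with the disturbances of `S` for `s ≤ t < e`.  Times are absolute,
unlike those of `IsTrajectory`. -/
def Follows (S : LTVProblem n m) (s e : ℕ) (x : ℕ → EuclideanSpace ℝ (Fin n))
    (u : ℕ → EuclideanSpace ℝ (Fin m)) : Prop :=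
  ∀ t, s ≤ t → t < e → x (t + 1) = S.A t (x t) + S.B t (u t) + S.w t

/-- The gradients of the state costs along `x`. -/
def gradState (S : LTVProblem n m) (x : ℕ → EuclideanSpace ℝ (Fin n)) (t : ℕ) :
    EuclideanSpace ℝ (Fin n) :=
  gradient (S.f t) (x t)

/-- The gradients of the control costs along `u`; the input at time `t` has the cost `c (t+1)`. -/
def gradInput (S : LTVProblem n m) (u : ℕ → EuclideanSpace ℝ (Fin m)) (t : ℕ) :
    EuclideanSpace ℝ (Fin m) :=
  gradient (S.c (t + 1)) (u t)

section

variable {s e : ℕ} {x x' : ℕ → EuclideanSpace ℝ (Fin n)} {u u' : ℕ → EuclideanSpace ℝ (Fin m)}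

theorem Follows.mono (h : S.Follows s e x u) {s' e' : ℕ} (hs : s ≤ s') (he : e' ≤ e) :
    S.Follows s' e' x u := fun t h1 h2 => h t (hs.trans h1) (h2.trans_le he)

theorem Follows.homogeneous_sub (h : S.Follows s e x u) (h' : S.Follows s e x' u') :
    S.Homogeneous s e (x - x') (u - u') := fun t h1 h2 => by
  simp only [Pi.sub_apply, map_sub, h t h1 h2, h' t h1 h2]; abel

theorem IsTrajectory.follows {t p : ℕ} {x₀ : EuclideanSpace ℝ (Fin n)}
    {y : ℕ → EuclideanSpace ℝ (Fin n)} {v : ℕ → EuclideanSpace ℝ (Fin m)}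
    (h : S.IsTrajectory t p x₀ (fun τ => S.w (t + τ)) y v) :
    S.Follows t (t + p) (fun τ => y (τ - t)) (fun τ => v (τ - t)) := fun τ h1 h2 => by
  obtain ⟨j, rfl⟩ := Nat.exists_eq_add_of_le h1
  have e1 : t + j + 1 - t = j + 1 := by omega
  simp only [e1, add_tsub_cancel_left]
  exact h.2 j (by omega)

theorem WellConditioned.gradientDifference (h : S.WellConditioned mf ℓf mc ℓc)
    (hx : S.Follows s e x u) (hx' : S.Follows s e x' u') (he : e ≤ S.T) :
    S.GradientDifference mf (max ℓf ℓc) s e (x - x') (u - u') (S.gradState x - S.gradState x')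
      (S.gradInput u - S.gradInput u') where
  hom := hx.homogeneous_sub hx'
  mono t h1 h2 := (h.f_convex t (by omega) (by omega)).monotone_gradient _ _
  coco_state t h1 h2 := ((h.f_smooth t (by omega) (by omega)).mono (le_max_left _ _)).cocoercive
    h.mf_pos.le (lt_max_of_lt_left h.ℓf_pos) (h.f_convex t (by omega) (by omega)) _ _
  coco_input t h1 h2 := ((h.c_smooth (t + 1) (by omega) (by omega)).mono
    (le_max_right _ _)).cocoercive h.mc_pos.le (lt_max_of_lt_left h.ℓf_pos)
    (h.c_convex (t + 1) (by omega) (by omega)) _ _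

theorem pairing_sub (g g' η : ℕ → EuclideanSpace ℝ (Fin n))
    (h h' ν : ℕ → EuclideanSpace ℝ (Fin m)) :
    pairing (g - g') (h - h') s e η ν = pairing g h s e η ν - pairing g' h' s e η ν := by
  unfold pairing
  rw [← Finset.sum_sub_distrib]
  refine Finset.sum_congr rfl fun t _ => ?_
  simp only [Pi.sub_apply, inner_sub_left]; ring

theorem FreeStationary.sub {g g' : ℕ → EuclideanSpace ℝ (Fin n)}
    {h h' : ℕ → EuclideanSpace ℝ (Fin m)} (H : S.FreeStationary g h s e)
    (H' : S.FreeStationary g' h' s e) : S.FreeStationary (g - g') (h - h') s e := by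
  rintro z v ⟨η, ν, h1, h2, h3, rfl⟩
  rw [pairing_sub, H z _ ⟨η, ν, h1, h2, h3, rfl⟩, H' z _ ⟨η, ν, h1, h2, h3, rfl⟩, sub_zero]

theorem FixedStationary.sub {g g' : ℕ → EuclideanSpace ℝ (Fin n)}
    {h h' : ℕ → EuclideanSpace ℝ (Fin m)} (H : S.FixedStationary g h s e)
    (H' : S.FixedStationary g' h' s e) : S.FixedStationary (g - g') (h - h') s e := by
  rintro v ⟨η, ν, h1, h2, h3, rfl⟩
  rw [pairing_sub, H _ ⟨η, ν, h1, h2, h3, rfl⟩, H' _ ⟨η, ν, h1, h2, h3, rfl⟩, sub_zero]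

end

/-- First-order condition along the perturbation `(η, ν)`, whose times are absolute. -/
theorem WellConditioned.pairing_eq_zero (h : S.WellConditioned mf ℓf mc ℓc) {t p : ℕ}
    (hT : t + p ≤ S.T) {y η : ℕ → EuclideanSpace ℝ (Fin n)} {v ν : ℕ → EuclideanSpace ℝ (Fin m)}
    (hmin : ∀ θ : ℝ, S.stepsCost t p y v
      ≤ S.stepsCost t p (fun j => y j + (θ • η) (t + j)) (fun j => v j + (θ • ν) (t + j))) :
    pairing (S.gradState fun τ => y (τ - t)) (S.gradInput fun τ => v (τ - t)) t (t + p) η ν = 0 := by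
  set φ : ℝ → ℝ := fun θ =>
    S.stepsCost t p (fun j => y j + (θ • η) (t + j)) (fun j => v j + (θ • ν) (t + j)) with hφ
  have h1 : HasDerivAt φ (pairing (S.gradState fun τ => y (τ - t))
      (S.gradInput fun τ => v (τ - t)) t (t + p) η ν) 0 := by
    simp only [hφ, stepsCost_eq_sum_range, pairing]
    rw [Finset.sum_Ico_eq_sum_range, add_tsub_cancel_left]
    refine HasDerivAt.fun_sum fun τ hτ => ?_
    have hτ' := Finset.mem_range.1 hτ
    have e1 : t + τ + 1 - t = τ + 1 := by omega
    have h2 := hasDerivAt_comp_line ((h.f_contDiff (t + τ + 1) (by omega) (by omega)).differentiable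
      (by norm_num)) (y (τ + 1)) (η (t + τ + 1))
    have h3 := hasDerivAt_comp_line ((h.c_contDiff (t + τ + 1) (by omega) (by omega)).differentiable
      (by norm_num)) (v τ) (ν (t + τ))
    simp only [gradState, gradInput, e1, add_tsub_cancel_left, Pi.smul_apply]
    exact h2.add h3
  have h2 : IsLocalMin φ 0 := Filter.Eventually.of_forall fun θ => by
    have := hmin θ
    simpa [hφ] using this
  exact h2.hasDerivAt_eq_zero h1

theorem IsOptimal.freeStationary (h : S.WellConditioned mf ℓf mc ℓc) {t p : ℕ}
    (hT : t + p ≤ S.T) {x : EuclideanSpace ℝ (Fin n)} {ζ y : ℕ → EuclideanSpace ℝ (Fin n)}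
    {v : ℕ → EuclideanSpace ℝ (Fin m)} (hopt : S.IsOptimal t p x ζ (fun _ => 0) y v) :
    S.FreeStationary (S.gradState fun τ => y (τ - t)) (S.gradInput fun τ => v (τ - t))
      t (t + p) := by
  rw [isOptimal_zero_iff] at hopt
  rintro z _ ⟨η, ν, h1, h2, -, rfl⟩
  refine h.pairing_eq_zero hT fun θ => hopt.2 _ _ ?_
  simpa [h2] using hopt.1.add_homogeneous (h1.smul θ)

theorem IsOptimal.fixedStationary (h : S.WellConditioned mf ℓf mc ℓc)
    (hS : S.UniformlyControllable d σ a b b') {t p : ℕ} (hdp : d ≤ p)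
    (hT : t + p ≤ S.T) {x : EuclideanSpace ℝ (Fin n)} {ζ y : ℕ → EuclideanSpace ℝ (Fin n)}
    {v : ℕ → EuclideanSpace ℝ (Fin m)} (hopt : S.IsOptimal t p x ζ originIndicator y v) :
    S.FixedStationary (S.gradState fun τ => y (τ - t)) (S.gradInput fun τ => v (τ - t))
      t (t + p) := by
  rw [isOptimal_originIndicator_iff (hS.exists_feasible hdp hT x ζ)] at hopt
  rintro _ ⟨η, ν, h1, h2, h3, rfl⟩
  refine h.pairing_eq_zero hT fun θ => hopt.2 _ _ ?_ ?_
  · simpa [h2] using hopt.1.1.add_homogeneous (h1.smul θ)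
  · simp [h3, hopt.1.2]

/-! ### Perturbation bounds for optimal trajectories -/

theorem constL0_pos (h : S.WellConditioned mf ℓf mc ℓc)
    (hS : S.UniformlyControllable d σ a b b') : 0 < constL0 d a b σ ℓf mc ℓc := by
  have hd := hS.d_pos
  refine lt_of_lt_of_le ?_ (le_constL0 h.mc_pos le_rfl (by omega))
  have h1 := one_le_constC hS.a_pos hS.b_pos hS.σ_pos d
  have h2 : 0 < max ℓf ℓc := lt_max_of_lt_left h.ℓf_pos
  positivity

theorem mf_le_constL0 (h : S.WellConditioned mf ℓf mc ℓc)
    (hS : S.UniformlyControllable d σ a b b') [NeZero n] (hT : 1 < S.T) :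
    mf ≤ constL0 d a b σ ℓf mc ℓc := by
  have hd := hS.d_pos
  refine le_trans ?_ (le_constL0 h.mc_pos le_rfl (by omega))
  have h1 := one_le_constC hS.a_pos hS.b_pos hS.σ_pos d
  have h2 := (h.f_convex 1 le_rfl hT.le).le_of_isStronglySmooth (h.f_smooth 1 le_rfl hT)
  have h3 : 0 < max ℓf ℓc := lt_max_of_lt_left h.ℓf_pos
  calc mf ≤ max ℓf ℓc := h2.trans (le_max_left _ _)
    _ = max ℓf ℓc * 1 ^ 2 := by ring
    _ ≤ _ := by gcongr

theorem norm_sub_le_of_freeStationary (h : S.WellConditioned mf ℓf mc ℓc)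
    (hS : S.UniformlyControllable d σ a b b') (hT : 1 < S.T) {s p : ℕ}
    {x x' : ℕ → EuclideanSpace ℝ (Fin n)} {u u' : ℕ → EuclideanSpace ℝ (Fin m)}
    (hx : S.Follows s S.T x u) (hx' : S.Follows s S.T x' u')
    (hst : S.FreeStationary (S.gradState x) (S.gradInput u) s S.T)
    (hst' : S.FreeStationary (S.gradState x') (S.gradInput u') s S.T)
    (hd : s + d ≤ S.T) (hp : s + p ≤ S.T) :
    ‖x (s + p) - x' (s + p)‖ ≤ decayConst (constL0 d a b σ ℓf mc ℓc) mf
      * decayRate d (constL0 d a b σ ℓf mc ℓc) mf ^ p * ‖x s - x' s‖ := by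
  have hL := constL0_pos h hS
  rcases Nat.eq_zero_or_pos n with rfl | hn
  · have e1 : ∀ z : EuclideanSpace ℝ (Fin 0), ‖z‖ = 0 := fun z => by
      rw [Subsingleton.elim z 0, norm_zero]
    simp [e1]
  · have : NeZero n := ⟨hn.ne'⟩
    have hmL := mf_le_constL0 h hS hT
    obtain ⟨N, hN, hpN, hle⟩ := (h.gradientDifference hx hx' le_rfl).exists_decay_of_free hS
      (lt_max_of_lt_left h.ℓf_pos) h.mf_pos.le hmL (fun p h1 h2 => le_constL0 h.mc_pos h1 h2)
      (rateBase_mem hL h.mf_pos).1 (rateBase_critical hL h.mf_pos).le (hst.sub hst') le_rfl hd hp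
    exact le_decayConst_mul_pow hS.d_pos h.mf_pos hmL hN hpN (norm_nonneg _) hle

theorem norm_sub_le_of_fixedStationary (h : S.WellConditioned mf ℓf mc ℓc)
    (hS : S.UniformlyControllable d σ a b b') (hT : 1 < S.T) {s p : ℕ}
    {x x' : ℕ → EuclideanSpace ℝ (Fin n)} {u u' : ℕ → EuclideanSpace ℝ (Fin m)}
    (hx : S.Follows s (s + (p + 1)) x u) (hx' : S.Follows s (s + (p + 1)) x' u')
    (hst : S.FixedStationary (S.gradState x) (S.gradInput u) s (s + (p + 1)))
    (hst' : S.FixedStationary (S.gradState x') (S.gradInput u') s (s + (p + 1)))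
    (h0 : x s = x' s) (hd : d ≤ p + 1) (hp : s + (p + 1) ≤ S.T) :
    ‖x (s + 1) - x' (s + 1)‖ ≤ decayConst (constL0 d a b σ ℓf mc ℓc) mf
      * decayRate d (constL0 d a b σ ℓf mc ℓc) mf ^ p
        * ‖x (s + (p + 1)) - x' (s + (p + 1))‖ := by
  have hL := constL0_pos h hS
  rcases Nat.eq_zero_or_pos n with rfl | hn
  · have e1 : ∀ z : EuclideanSpace ℝ (Fin 0), ‖z‖ = 0 := fun z => by
      rw [Subsingleton.elim z 0, norm_zero]
    simp [e1]
  · have : NeZero n := ⟨hn.ne'⟩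
    have hmL := mf_le_constL0 h hS hT
    obtain ⟨N, hN, hpN, hle⟩ := (h.gradientDifference hx hx' hp).exists_decay_of_fixed hS
      (lt_max_of_lt_left h.ℓf_pos) h.mf_pos.le hmL (fun p h1 h2 => le_constL0 h.mc_pos h1 h2)
      (rateBase_mem hL h.mf_pos).1 (rateBase_critical hL h.mf_pos).le (hst.sub hst')
      (sub_eq_zero.2 h0) hp hd
    exact le_decayConst_mul_pow hS.d_pos h.mf_pos hmL hN hpN (norm_nonneg _) hle

/-! ### Cost comparison -/

/-- The first input of an optimal plan is cheapest among those with the same effect. -/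
theorem IsOptimal.input_le (hS : S.UniformlyControllable d σ a b b') {t k : ℕ} (hdk : d ≤ k)
    (hT : t + k ≤ S.T) {x : EuclideanSpace ℝ (Fin n)} {ζ y : ℕ → EuclideanSpace ℝ (Fin n)}
    {v : ℕ → EuclideanSpace ℝ (Fin m)} (hopt : S.IsOptimal t k x ζ originIndicator y v)
    {u : EuclideanSpace ℝ (Fin m)} (hu : S.B t u = S.B t (v 0)) :
    S.c (t + 1) (v 0) ≤ S.c (t + 1) u := by
  rw [isOptimal_originIndicator_iff (hS.exists_feasible hdk hT x ζ)] at hopt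
  obtain ⟨⟨⟨h0, h1⟩, h2⟩, h3⟩ := hopt
  have h4 := h3 y (Function.update v 0 u) ⟨h0, fun τ hτ => by
    rcases Nat.eq_zero_or_pos τ with rfl | hτ0
    · simp only [Function.update_self, add_zero, hu]
      exact h1 0 hτ
    · rw [Function.update_of_ne hτ0.ne']
      exact h1 τ hτ⟩ h2
  obtain ⟨q, rfl⟩ : ∃ q, k = q + 1 := ⟨k - 1, by have := hS.d_pos; omega⟩
  rw [stepsCost_eq_sum_range, stepsCost_eq_sum_range, Finset.sum_range_succ',
    Finset.sum_range_succ'] at h4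
  simpa using h4

/-- Steering from `x` to the origin in `d` steps, and resting there until time `s + k`. -/
theorem UniformlyControllable.exists_steering_zero (h : S.UniformlyControllable d σ a b b')
    {s k : ℕ} (hdk : d ≤ k) (hT : s + k ≤ S.T) (x : EuclideanSpace ℝ (Fin n)) :
    ∃ η ν, S.Homogeneous s (s + k) η ν ∧ η s = x ∧ η (s + k) = 0 ∧
      ∑ j ∈ Finset.range k, (‖η (s + j + 1)‖ ^ 2 + ‖ν (s + j)‖ ^ 2)
        ≤ constC a b σ d ^ 2 * ‖x‖ ^ 2 := by
  obtain ⟨η, ν, hK⟩ := h.exists_steering le_rfl (by omega : s + d ≤ S.T)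
  obtain ⟨h1, h2, h3, h4⟩ := hK (x, 0)
  refine ⟨fun t => if t ≤ s + d then η t (x, 0) else 0, fun t => if t < s + d then ν t (x, 0) else 0,
    fun t ht ht' => ?_, ?_, ?_, ?_⟩
  · rcases lt_trichotomy t (s + d) with i | i | i
    · simp only [if_pos i, if_pos i.le, if_pos (Nat.succ_le_of_lt i)]
      exact h1 t ht i
    · subst i
      simp [h3]
    · have i1 : ¬ t + 1 ≤ s + d := by omega
      have i2 : ¬ t ≤ s + d := by omega
      have i3 : ¬ t < s + d := by omega
      simp [if_neg i2, if_neg i3]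
  · simpa using h2
  · dsimp only
    split_ifs with i
    · obtain rfl : k = d := by omega
      exact h3
    · rfl
  · obtain ⟨q, rfl⟩ := Nat.exists_eq_add_of_le hdk
    rw [Finset.sum_range_add, Finset.sum_eq_zero (s := Finset.range q), add_zero]
    · refine le_trans (le_of_eq ?_) (h4.trans_eq (by simp))
      rw [← Finset.sum_add_distrib]
      refine Finset.sum_congr rfl fun j hj => ?_
      have hj' := Finset.mem_range.1 hj
      have i1 : s + j + 1 ≤ s + d := by omega
      have i2 : s + j < s + d := by omega
      simp only [if_pos i1, if_pos i2]
      ring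
    · intro j _
      have i1 : ¬ s + (d + j) + 1 ≤ s + d := by omega
      have i2 : ¬ s + (d + j) < s + d := by omega
      simp only [if_neg i1, if_neg i2]
      simp

/-- Sensitivity of the optimal cost over the last `k ≥ d` steps to the initial state: steer onto the
reference trajectory within `d` steps.  The final state cost need not be smooth since the final
state is that of the reference. -/
theorem WellConditioned.stepsCost_le (h : S.WellConditioned mf ℓf mc ℓc)
    (hS : S.UniformlyControllable d σ a b b') {N k : ℕ} (hdk : d ≤ k) (hT : N + k = S.T)
    {x x' : EuclideanSpace ℝ (Fin n)} {ζ y y' : ℕ → EuclideanSpace ℝ (Fin n)}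
    {v v' : ℕ → EuclideanSpace ℝ (Fin m)} (hopt : S.IsOptimal N k x ζ (fun _ => 0) y v)
    (htraj : S.IsTrajectory N k x' ζ y' v') {θ : ℝ} (hθ : 0 < θ) :
    S.stepsCost N k y v ≤ (1 + θ) * S.stepsCost N k y' v'
      + (1 + 1 / θ) * (constL0 d a b σ ℓf mc ℓc / 2 * ‖x - x'‖ ^ 2) := by
  have hd := hS.d_pos
  obtain ⟨η, ν, h1, h2, h3, h4⟩ := hS.exists_steering_zero hdk hT.le (x - x')
  have h5 := htraj.add_homogeneous h1
  rw [h2, add_sub_cancel] at h5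
  refine ((isOptimal_zero_iff.1 hopt).2 _ _ h5).trans ?_
  have hℓ : 0 < max ℓf ℓc := lt_max_of_lt_left h.ℓf_pos
  have h6 : S.stepsCost N k (fun j => y' j + η (N + j)) (fun j => v' j + ν (N + j))
      ≤ ∑ j ∈ Finset.range k, ((1 + θ) * (S.f (N + j + 1) (y' (j + 1)) + S.c (N + j + 1) (v' j))
        + (1 + 1 / θ) * (max ℓf ℓc / 2 * (‖η (N + j + 1)‖ ^ 2 + ‖ν (N + j)‖ ^ 2))) := by
    rw [stepsCost_eq_sum_range]
    refine Finset.sum_le_sum fun j hj => ?_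
    have hj' := Finset.mem_range.1 hj
    have hf : S.f (N + j + 1) (y' (j + 1) + η (N + (j + 1)))
        ≤ (1 + θ) * S.f (N + j + 1) (y' (j + 1))
          + (1 + 1 / θ) * (max ℓf ℓc / 2 * ‖η (N + j + 1)‖ ^ 2) := by
      by_cases hjk : j + 1 = k
      · have : 0 ≤ θ * S.f (N + j + 1) (y' (j + 1)) :=
          mul_nonneg hθ.le (h.f_nonneg _ (by omega) (by omega) _)
        have e1 : N + j + 1 = N + (j + 1) := by ring
        rw [e1] at this ⊢
        rw [hjk, h3] at *
        simp only [add_zero, norm_zero]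
        linarith
      · exact ((h.f_smooth _ (by omega) (by omega)).mono (le_max_left _ _)).add_le hℓ
          (h.f_nonneg _ (by omega) (by omega)) hθ _ _
    have hc : S.c (N + j + 1) (v' j + ν (N + j)) ≤ (1 + θ) * S.c (N + j + 1) (v' j)
          + (1 + 1 / θ) * (max ℓf ℓc / 2 * ‖ν (N + j)‖ ^ 2) :=
      ((h.c_smooth _ (by omega) (by omega)).mono (le_max_right _ _)).add_le hℓ
          (h.c_nonneg _ (by omega) (by omega)) hθ _ _
    refine (add_le_add hf hc).trans (le_of_eq (by ring))
  refine h6.trans ?_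
  rw [Finset.sum_add_distrib, ← Finset.mul_sum, ← Finset.mul_sum, ← Finset.mul_sum,
    ← stepsCost_eq_sum_range]
  refine add_le_add le_rfl (mul_le_mul_of_nonneg_left ?_ (by positivity))
  have h7 := le_constL0 (ℓf := ℓf) (ℓc := ℓc) (a := a) (b := b) (σ := σ) h.mc_pos (le_refl d)
    (by omega)
  calc _ ≤ max ℓf ℓc / 2 * (constC a b σ d ^ 2 * ‖x - x'‖ ^ 2) := by gcongr
    _ = (max ℓf ℓc * constC a b σ d ^ 2) / 2 * ‖x - x'‖ ^ 2 := by ring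
    _ ≤ _ := by gcongr

theorem cost_eq_sum_add_stepsCost {N k : ℕ} (hT : N + k = S.T) (x : ℕ → EuclideanSpace ℝ (Fin n))
    (u : ℕ → EuclideanSpace ℝ (Fin m)) :
    S.cost x u = ∑ t ∈ Finset.range N, (S.f (t + 1) (x (t + 1)) + S.c (t + 1) (u t))
      + S.stepsCost N k (fun j => x (N + j)) (fun j => u (N + j)) := by
  unfold cost
  rw [stepsCost_eq_sum_range, stepsCost_eq_sum_range, ← hT, Finset.sum_range_add]
  simp only [zero_add]
  rfl

theorem norm_sub_sq_le {V : Type*} [NormedAddCommGroup V] [InnerProductSpace ℝ V] (x y : V) :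
    ‖x - y‖ ^ 2 ≤ 2 * (‖x‖ ^ 2 + ‖y‖ ^ 2) := by
  have h1 := parallelogram_law_with_norm ℝ x y
  nlinarith [sq_nonneg ‖x + y‖]

/-- The cost of predictive control in terms of the deviation from a reference trajectory. -/
theorem IsPredictiveControl.cost_le (h : S.WellConditioned mf ℓf mc ℓc)
    (hS : S.UniformlyControllable d σ a b b') {N k : ℕ} (hdk : d ≤ k) (hT : N + k = S.T)
    (hN : 0 < N) {x x' : ℕ → EuclideanSpace ℝ (Fin n)} {u u' : ℕ → EuclideanSpace ℝ (Fin m)}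
    (hpc : S.IsPredictiveControl k originIndicator x u)
    (htraj : S.IsTrajectory 0 S.T S.x0 S.w x' u') {θ : ℝ} (hθ : 0 < θ) :
    S.cost x u ≤ (1 + θ) * S.cost x' u' + (1 + 1 / θ) *
      ((2 * ℓf + 4 * b' ^ 2 * ℓc + 4 * a ^ 2 * b' ^ 2 * ℓc + constL0 d a b σ ℓf mc ℓc + ℓf) / 2
        * ∑ t ∈ Finset.range N, ‖x (t + 1) - x' (t + 1)‖ ^ 2) := by
  have hd := hS.d_pos
  have hℓf := h.ℓf_pos
  have hℓc := h.ℓc_pos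
  have hL := constL0_pos h hS
  obtain ⟨⟨hx0, hx⟩, hplan, y, v, hyv, huv⟩ := hpc
  have hTk : S.T - k = N := by omega
  rw [hTk] at hyv huv
  simp only [zero_add] at hx
  have hx' := htraj.2
  simp only [zero_add] at hx'
  -- `u` and the plan `v` agree on the last `k` steps, hence so do the states.
  have htail : S.stepsCost N k (fun j => x (N + j)) (fun j => u (N + j)) = S.stepsCost N k y v := by
    have h1 : S.IsTrajectory N k (x N) (fun τ => S.w (N + τ)) (fun j => x (N + j))
        (fun j => u (N + j)) := ⟨rfl, fun τ hτ => hx (N + τ) (by omega)⟩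
    exact stepsCost_congr (h1.eq_of_input_eq hyv.1 huv) huv
  have htail_le := h.stepsCost_le hS hdk hT hyv (y' := fun j => x' (N + j))
    (v' := fun j => u' (N + j)) ⟨rfl, fun τ hτ => hx' (N + τ) (by omega)⟩ hθ
  simp only [add_zero] at htail_le
  -- Before time `N` states and inputs are compared one by one; there every state cost is smooth.
  have hstep : ∀ t ∈ Finset.range N, S.f (t + 1) (x (t + 1)) + S.c (t + 1) (u t)
      ≤ (1 + θ) * (S.f (t + 1) (x' (t + 1)) + S.c (t + 1) (u' t)) + (1 + 1 / θ)
        * ((ℓf / 2 + ℓc * b' ^ 2) * ‖x (t + 1) - x' (t + 1)‖ ^ 2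
          + ℓc * b' ^ 2 * a ^ 2 * ‖x t - x' t‖ ^ 2) := fun t ht => by
    have ht' := Finset.mem_range.1 ht
    have hf := (h.f_smooth (t + 1) (by omega) (by omega)).add_le hℓf
      (h.f_nonneg _ (by omega) (by omega)) hθ (x' (t + 1)) (x (t + 1) - x' (t + 1))
    rw [add_sub_cancel] at hf
    obtain ⟨R, ⟨hR, -⟩, hRn⟩ := hS.norm_Bdag t (by omega)
    obtain ⟨y', v', hopt, hv0⟩ := hplan t (by omega)
    set δ := x (t + 1) - x' (t + 1) - S.A t (x t - x' t) with hδ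
    have hBδ : δ = S.B t (u t - u' t) := by
      rw [hδ, hx t (by omega), hx' t (by omega), map_sub, map_sub]; abel
    have hBR : S.B t (u' t + R δ) = S.B t (v' 0) := by
      have : S.B t (R δ) = δ := by
        rw [hBδ]
        exact DFunLike.congr_fun hR (u t - u' t)
      rw [map_add, this, hBδ, map_sub, ← hv0]; abel
    have hc1 := hopt.input_le hS hdk (by omega) hBR
    rw [← hv0] at hc1
    have hc2 := (h.c_smooth (t + 1) (by omega) (by omega)).add_le hℓc
      (h.c_nonneg _ (by omega) (by omega)) hθ (u' t) (R δ)
    have hRδ : ‖R δ‖ ^ 2 ≤ b' ^ 2 * (2 * (‖x (t + 1) - x' (t + 1)‖ ^ 2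
        + a ^ 2 * ‖x t - x' t‖ ^ 2)) := by
      have h1 : ‖R δ‖ ≤ b' * ‖δ‖ := R.le_of_opNorm_le hRn δ
      have h2 : ‖S.A t (x t - x' t)‖ ≤ a * ‖x t - x' t‖ :=
        (S.A t).le_of_opNorm_le (hS.norm_A t (by omega)) _
      calc ‖R δ‖ ^ 2 ≤ (b' * ‖δ‖) ^ 2 := by gcongr
        _ = b' ^ 2 * ‖δ‖ ^ 2 := by ring
        _ ≤ b' ^ 2 * (2 * (‖x (t + 1) - x' (t + 1)‖ ^ 2 + ‖S.A t (x t - x' t)‖ ^ 2)) := by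
            gcongr; exact norm_sub_sq_le _ _
        _ ≤ b' ^ 2 * (2 * (‖x (t + 1) - x' (t + 1)‖ ^ 2 + (a * ‖x t - x' t‖) ^ 2)) := by gcongr
        _ = _ := by ring
    have h3 : (1 + 1 / θ) * (ℓc / 2 * ‖R δ‖ ^ 2) ≤ (1 + 1 / θ) * (ℓc / 2 * (b' ^ 2
        * (2 * (‖x (t + 1) - x' (t + 1)‖ ^ 2 + a ^ 2 * ‖x t - x' t‖ ^ 2)))) := by gcongr
    linarith
  have hsum := Finset.sum_le_sum hstep
  have hsplit : ∑ t ∈ Finset.range N, ((1 + θ) * (S.f (t + 1) (x' (t + 1)) + S.c (t + 1) (u' t))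
        + (1 + 1 / θ) * ((ℓf / 2 + ℓc * b' ^ 2) * ‖x (t + 1) - x' (t + 1)‖ ^ 2
          + ℓc * b' ^ 2 * a ^ 2 * ‖x t - x' t‖ ^ 2))
      = (1 + θ) * (∑ t ∈ Finset.range N, (S.f (t + 1) (x' (t + 1)) + S.c (t + 1) (u' t)))
        + (1 + 1 / θ) * ((ℓf / 2 + ℓc * b' ^ 2) * (∑ t ∈ Finset.range N, ‖x (t + 1) - x' (t + 1)‖ ^ 2)
          + ℓc * b' ^ 2 * a ^ 2 * (∑ t ∈ Finset.range N, ‖x t - x' t‖ ^ 2)) := by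
    simp only [Finset.mul_sum, ← Finset.sum_add_distrib]
  rw [hsplit] at hsum
  have hshift : ∑ t ∈ Finset.range N, ‖x t - x' t‖ ^ 2
      ≤ ∑ t ∈ Finset.range N, ‖x (t + 1) - x' (t + 1)‖ ^ 2 := by
    have h1 := Finset.sum_range_succ (fun t => ‖x t - x' t‖ ^ 2) N
    rw [Finset.sum_range_succ' (fun t => ‖x t - x' t‖ ^ 2) N, hx0, htraj.1, sub_self, norm_zero]
      at h1
    have h2 := sq_nonneg ‖x N - x' N‖
    linarith
  have hlast : ‖x N - x' N‖ ^ 2 ≤ ∑ t ∈ Finset.range N, ‖x (t + 1) - x' (t + 1)‖ ^ 2 := by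
    obtain ⟨M, rfl⟩ : ∃ M, N = M + 1 := ⟨N - 1, by omega⟩
    exact Finset.single_le_sum (f := fun t => ‖x (t + 1) - x' (t + 1)‖ ^ 2)
      (fun t _ => sq_nonneg _) (Finset.self_mem_range_succ M)
  rw [cost_eq_sum_add_stepsCost hT x u, cost_eq_sum_add_stepsCost hT x' u', htail]
  set Z := ∑ t ∈ Finset.range N, ‖x (t + 1) - x' (t + 1)‖ ^ 2
  have hZ : 0 ≤ Z := (sq_nonneg _).trans hlast
  have h1 : (ℓf / 2 + ℓc * b' ^ 2) * Z + ℓc * b' ^ 2 * a ^ 2 * (∑ t ∈ Finset.range N, ‖x t - x' t‖ ^ 2)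
      + constL0 d a b σ ℓf mc ℓc / 2 * ‖x N - x' N‖ ^ 2
      ≤ (2 * ℓf + 4 * b' ^ 2 * ℓc + 4 * a ^ 2 * b' ^ 2 * ℓc + constL0 d a b σ ℓf mc ℓc + ℓf) / 2
        * Z := by
    have i1 : ℓc * b' ^ 2 * a ^ 2 * (∑ t ∈ Finset.range N, ‖x t - x' t‖ ^ 2)
      ≤ ℓc * b' ^ 2 * a ^ 2 * Z := by gcongr
    have i2 : constL0 d a b σ ℓf mc ℓc / 2 * ‖x N - x' N‖ ^ 2
      ≤ constL0 d a b σ ℓf mc ℓc / 2 * Z := by gcongr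
    have i3 : 0 ≤ ℓf * Z := by positivity
    have i4 : 0 ≤ ℓc * b' ^ 2 * Z := by positivity
    have i5 : 0 ≤ ℓc * b' ^ 2 * a ^ 2 * Z := by positivity
    linarith
  have h2 := mul_le_mul_of_nonneg_left h1 (by positivity : 0 ≤ 1 + 1 / θ)
  linarith

end LTVProblem

/-! ### The competitive ratio -/

/-- A discounted sum has `ℓ²` norm at most `1 / (1 - r)` times that of its summands. -/
theorem sum_sq_discounted_le {r : ℝ} (hr : 0 ≤ r) (hr1 : r < 1) {s e : ℕ → ℝ} (h0 : s 0 = 0)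
    (hs : ∀ t, s (t + 1) = r * s t + e t) (N : ℕ) :
    (1 - r) ^ 2 * ∑ t ∈ Finset.range N, s (t + 1) ^ 2 ≤ ∑ t ∈ Finset.range N, e t ^ 2 := by
  have h1 : ∀ t, (1 - r) * s (t + 1) ^ 2 ≤ (1 - r) * (r * s t ^ 2) + e t ^ 2 := fun t => by
    rw [hs t]
    nlinarith [mul_nonneg hr (sq_nonneg ((1 - r) * s t - e t))]
  have h2 := Finset.sum_le_sum fun t (_ : t ∈ Finset.range N) => h1 t
  rw [Finset.sum_add_distrib, ← Finset.mul_sum, ← Finset.mul_sum, ← Finset.mul_sum] at h2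
  have h3 := Finset.sum_range_succ (fun t => s t ^ 2) N
  rw [Finset.sum_range_succ' (fun t => s t ^ 2) N, h0] at h3
  have h4 : ∑ t ∈ Finset.range N, s t ^ 2 ≤ ∑ t ∈ Finset.range N, s (t + 1) ^ 2 := by
    have := sq_nonneg (s N)
    linarith
  have h5 : (1 - r) * (r * ∑ t ∈ Finset.range N, s t ^ 2)
      ≤ (1 - r) * (r * ∑ t ∈ Finset.range N, s (t + 1) ^ 2) :=
    mul_le_mul_of_nonneg_left (mul_le_mul_of_nonneg_left h4 hr) (by linarith)
  nlinarith

/-- The lower bound on the window length, without logarithms. -/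
theorem mul_pow_le_of_log_div_le {C lam ε : ℝ} (hC : 0 < C) (hl0 : 0 < lam) (hl1 : lam < 1)
    (hε : ε < 1) {k : ℕ}
    (hk : Real.log (6 * C ^ 6 / ((1 - ε) * lam ^ 2 * (1 - lam) ^ 2 * (1 - lam ^ 2) ^ 2))
      / (4 * Real.log (1 / lam)) ≤ (k : ℝ)) :
    6 * C ^ 6 * lam ^ (4 * k) ≤ (1 - ε) * (lam ^ 2 * (1 - lam) ^ 2 * (1 - lam ^ 2) ^ 2) := by
  have h1 : 0 < 1 - lam := by linarith
  have h2 : 0 < 1 - lam ^ 2 := by nlinarith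
  have h3 : 0 < 1 - ε := by linarith
  have hden : 0 < (1 - ε) * lam ^ 2 * (1 - lam) ^ 2 * (1 - lam ^ 2) ^ 2 := by positivity
  have hlog : 0 < Real.log (1 / lam) := Real.log_pos (by rw [lt_div_iff₀ hl0]; linarith)
  rw [div_le_iff₀ (by positivity)] at hk
  have h4 : (k : ℝ) * (4 * Real.log (1 / lam)) = Real.log ((1 / lam) ^ (4 * k)) := by
    rw [Real.log_pow]; push_cast; ring
  rw [h4, Real.log_le_log_iff (by positivity) (by positivity), div_le_iff₀ hden, one_div,
    inv_pow, ← div_eq_inv_mul, le_div_iff₀ (by positivity)] at hk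
  linarith

/-- Closing the loop: the planning errors `e` are small relative to the reference and to the
deviation `D`, and the deviation is a discounted sum of the planning errors. -/
theorem sum_sq_deviation_le {C lam ε q : ℝ} {k N : ℕ} (hl0 : 0 < lam) (hl1 : lam < 1)
    (hqk : q * lam = lam ^ k)
    (hk : 6 * C ^ 6 * lam ^ (4 * k) ≤ (1 - ε) * (lam ^ 2 * (1 - lam) ^ 2 * (1 - lam ^ 2) ^ 2))
    (hε : ε < 1) {s e D ξ : ℕ → ℝ} (h0 : s 0 = 0) (hs : ∀ t, s (t + 1) = lam * s t + e t)
    (hD0 : D 0 = 0) (hDnn : ∀ t, 0 ≤ D t) (hD : ∀ t, t ≤ N → D t ≤ C * s t) (he0 : ∀ t, 0 ≤ e t)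
    (he : ∀ t, t < N → e t ≤ C * q * (ξ t + C * lam ^ k * D t)) :
    ε * (lam ^ 2 * (1 - lam) ^ 2) * ∑ t ∈ Finset.range N, D (t + 1) ^ 2
      ≤ 2 * C ^ 4 * lam ^ (2 * k) * ∑ t ∈ Finset.range N, ξ t ^ 2 := by
  set Z := ∑ t ∈ Finset.range N, D (t + 1) ^ 2 with hZ
  have hZ0 : 0 ≤ Z := Finset.sum_nonneg fun t _ => sq_nonneg _
  have h1 : Z ≤ C ^ 2 * ∑ t ∈ Finset.range N, s (t + 1) ^ 2 := by
    rw [hZ, Finset.mul_sum]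
    refine Finset.sum_le_sum fun t ht => ?_
    rw [← mul_pow]
    exact pow_le_pow_left₀ (hDnn _) (hD _ (Finset.mem_range.1 ht)) 2
  have h2 := sum_sq_discounted_le hl0.le hl1 h0 hs N
  have h3 : ∑ t ∈ Finset.range N, e t ^ 2 ≤ 2 * C ^ 2 * q ^ 2 * ((∑ t ∈ Finset.range N, ξ t ^ 2)
      + C ^ 2 * lam ^ (2 * k) * ∑ t ∈ Finset.range N, D t ^ 2) := by
    rw [Finset.mul_sum (Finset.range N) (fun t => D t ^ 2), ← Finset.sum_add_distrib,
      Finset.mul_sum]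
    refine Finset.sum_le_sum fun t ht => ?_
    have h4 := pow_le_pow_left₀ (he0 t) (he t (Finset.mem_range.1 ht)) 2
    refine h4.trans ?_
    have e1 : lam ^ (2 * k) = (lam ^ k) ^ 2 := by rw [← pow_mul, mul_comm]
    rw [e1]
    calc (C * q * (ξ t + C * lam ^ k * D t)) ^ 2
        = (C * q) ^ 2 * (ξ t + C * lam ^ k * D t) ^ 2 := by ring
      _ ≤ (C * q) ^ 2 * (2 * (ξ t ^ 2 + (C * lam ^ k * D t) ^ 2)) := by
          gcongr; exact add_sq_le
      _ = _ := by ring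
  have h5 : ∑ t ∈ Finset.range N, D t ^ 2 ≤ Z := by
    have i1 := Finset.sum_range_succ (fun t => D t ^ 2) N
    rw [Finset.sum_range_succ' (fun t => D t ^ 2) N, hD0] at i1
    have := sq_nonneg (D N)
    linarith
  set Ξ := ∑ t ∈ Finset.range N, ξ t ^ 2
  have h6 : (1 - lam) ^ 2 * Z ≤ C ^ 2 * (2 * C ^ 2 * q ^ 2 * (Ξ + C ^ 2 * lam ^ (2 * k) * Z)) := by
    calc (1 - lam) ^ 2 * Z ≤ (1 - lam) ^ 2 * (C ^ 2 * ∑ t ∈ Finset.range N, s (t + 1) ^ 2) := by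
          gcongr
      _ = C ^ 2 * ((1 - lam) ^ 2 * ∑ t ∈ Finset.range N, s (t + 1) ^ 2) := by ring
      _ ≤ C ^ 2 * (2 * C ^ 2 * q ^ 2 * (Ξ + C ^ 2 * lam ^ (2 * k)
            * ∑ t ∈ Finset.range N, D t ^ 2)) := by
          refine mul_le_mul_of_nonneg_left (h2.trans h3) (sq_nonneg _)
      _ ≤ _ := by gcongr
  have h7 : q ^ 2 * lam ^ 2 = lam ^ (2 * k) := by rw [← mul_pow, hqk, ← pow_mul, mul_comm]
  have h8 : lam ^ (2 * k) * lam ^ (2 * k) = lam ^ (4 * k) := by rw [← pow_add]; congr 1; ring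
  have h9 : lam ^ 2 * (1 - lam) ^ 2 * Z ≤ 2 * C ^ 4 * lam ^ (2 * k) * Ξ
      + 2 * C ^ 6 * lam ^ (4 * k) * Z := by
    calc lam ^ 2 * (1 - lam) ^ 2 * Z = lam ^ 2 * ((1 - lam) ^ 2 * Z) := by ring
      _ ≤ lam ^ 2 * (C ^ 2 * (2 * C ^ 2 * q ^ 2 * (Ξ + C ^ 2 * lam ^ (2 * k) * Z))) := by gcongr
      _ = 2 * C ^ 4 * (q ^ 2 * lam ^ 2) * Ξ
          + 2 * C ^ 6 * ((q ^ 2 * lam ^ 2) * lam ^ (2 * k)) * Z := by ring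
      _ = _ := by rw [h7, h8]
  have h10 : 2 * C ^ 6 * lam ^ (4 * k) ≤ (1 - ε) * (lam ^ 2 * (1 - lam) ^ 2) := by
    have i0 : 0 < 1 - lam ^ 2 := by nlinarith
    have i1 : (1 - lam ^ 2) ^ 2 ≤ 1 := by nlinarith [sq_nonneg lam]
    have i2 : 0 ≤ C ^ 6 * lam ^ (4 * k) := by positivity
    have i3 : (1 - ε) * (lam ^ 2 * (1 - lam) ^ 2 * (1 - lam ^ 2) ^ 2)
        ≤ (1 - ε) * (lam ^ 2 * (1 - lam) ^ 2 * 1) := by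
      have : 0 ≤ 1 - ε := by linarith
      gcongr
    linarith
  have h11 := mul_le_mul_of_nonneg_right h10 hZ0
  linarith

namespace LTVProblem

variable {n m : ℕ} {S : LTVProblem n m} {d : ℕ} {σ a b b' mf ℓf mc ℓc : ℝ}

/-- The clairvoyant continuation from a state at time `t ≤ T`, in absolute time. -/
theorem WellConditioned.exists_clairvoyant (h : S.WellConditioned mf ℓf mc ℓc) {t : ℕ}
    (ht : t ≤ S.T) (x₀ : EuclideanSpace ℝ (Fin n)) :
    ∃ x u, x t = x₀ ∧ S.Follows t S.T x u ∧
      S.FreeStationary (S.gradState x) (S.gradInput u) t S.T := by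
  obtain ⟨p, hp⟩ := Nat.exists_eq_add_of_le ht
  obtain ⟨y, v, hyv⟩ := h.exists_isOptimal_zero hp.ge x₀ (fun τ => S.w (t + τ))
  have h1 := hyv.1.follows
  have h2 := hyv.freeStationary h hp.ge
  rw [← hp] at h1 h2
  exact ⟨_, _, by simpa using hyv.1.1, h1, h2⟩

/-- The deviation of predictive control from an optimal trajectory is small compared with the size
of that trajectory. -/
theorem IsPredictiveControl.sum_sq_deviation_le (h : S.WellConditioned mf ℓf mc ℓc)
    (hS : S.UniformlyControllable d σ a b b') {N k : ℕ} (hdk : d ≤ k) (hT : N + k = S.T)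
    (hT1 : 1 < S.T) {x X : ℕ → EuclideanSpace ℝ (Fin n)} {u U : ℕ → EuclideanSpace ℝ (Fin m)}
    (hpc : S.IsPredictiveControl k originIndicator x u)
    (hopt : S.IsOptimal 0 S.T S.x0 S.w (fun _ => 0) X U)
    {L0 C lam ε : ℝ} (hL0 : L0 = constL0 d a b σ ℓf mc ℓc) (hC : C = decayConst L0 mf)
    (hlam : lam = decayRate d L0 mf) (hε1 : ε < 1)
    (hk : 6 * C ^ 6 * lam ^ (4 * k) ≤ (1 - ε) * (lam ^ 2 * (1 - lam) ^ 2 * (1 - lam ^ 2) ^ 2)) :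
    ε * (lam ^ 2 * (1 - lam) ^ 2) * ∑ t ∈ Finset.range N, ‖x (t + 1) - X (t + 1)‖ ^ 2
      ≤ 2 * C ^ 4 * lam ^ (2 * k) * ∑ t ∈ Finset.range N, ‖X (t + k)‖ ^ 2 := by
  subst hL0
  have hd := hS.d_pos
  have hL := constL0_pos h hS
  obtain ⟨hl0, hl1⟩ := decayRate_mem hd hL h.mf_pos
  have hC0 : 0 ≤ C := hC ▸ zero_le_one.trans (decayConst_ge_one hL h.mf_pos)
  rw [← hlam] at hl0 hl1
  have hX : S.Follows 0 S.T X U := by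
    simpa using IsTrajectory.follows (S := S) (t := 0) (by simpa using hopt.1)
  have hXst : S.FreeStationary (S.gradState X) (S.gradInput U) 0 S.T := by
    simpa using hopt.freeStationary h (by omega)
  have hXst' : ∀ t, t ≤ S.T → S.FreeStationary (S.gradState X) (S.gradInput U) t S.T :=
    fun t ht => hXst.mono_left (Nat.zero_le t) ht
  -- `Y t` is the clairvoyant continuation of the state of the run at time `t`.
  have hcl : ∀ t, ∃ y v, t ≤ S.T → y t = x t ∧ S.Follows t S.T y v ∧
      S.FreeStationary (S.gradState y) (S.gradInput v) t S.T := fun t => by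
    by_cases ht : t ≤ S.T
    · obtain ⟨y, v, hyv⟩ := h.exists_clairvoyant ht (x t)
      exact ⟨y, v, fun _ => hyv⟩
    · exact ⟨0, 0, fun h => absurd h ht⟩
  choose Y V hYV using hcl
  set e : ℕ → ℝ := fun t => ‖x (t + 1) - Y t (t + 1)‖ with he
  set s : ℕ → ℝ := fun t => Nat.rec 0 (fun t r => lam * r + e t) t with hs
  have hs' : ∀ t, s (t + 1) = lam * s t + e t := fun t => rfl
  have hx0 : x 0 = X 0 := by rw [hpc.1.1, hopt.1.1]
  -- `Y (r + 1)` and `Y r` are both stationary from time `r + 1` on, and differ there by `e r`.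
  have htel : ∀ r, r ≤ N → ∀ p, r + p ≤ S.T → ‖Y r (r + p) - X (r + p)‖ ≤ C * lam ^ p * s r := by
    intro r
    induction r with
    | zero =>
      intro _ p hp
      obtain ⟨i1, i2, i3⟩ := hYV 0 (Nat.zero_le _)
      have := norm_sub_le_of_freeStationary h hS hT1 i2 hX i3 hXst (by omega) hp
      rw [i1, hx0, sub_self, norm_zero, mul_zero] at this
      simpa [hs] using this
    | succ r ih =>
      intro hr p hp
      obtain ⟨i1, i2, i3⟩ := hYV r (by omega)
      obtain ⟨j1, j2, j3⟩ := hYV (r + 1) (by omega)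
      have h1 := norm_sub_le_of_freeStationary h hS hT1 j2 (i2.mono (Nat.le_succ r) le_rfl) j3
        (i3.mono_left (Nat.le_succ r) (by omega)) (by omega) hp
      rw [j1, ← hlam, ← hC] at h1
      have h2 := ih (by omega) (p + 1) (by omega)
      have e1 : r + (p + 1) = r + 1 + p := by ring
      rw [e1] at h2
      calc _ ≤ ‖Y (r + 1) (r + 1 + p) - Y r (r + 1 + p)‖ + ‖Y r (r + 1 + p) - X (r + 1 + p)‖ :=
            norm_sub_le_norm_sub_add_norm_sub _ _ _
        _ ≤ C * lam ^ p * e r + C * lam ^ (p + 1) * s r := add_le_add h1 h2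
        _ = C * lam ^ p * s (r + 1) := by rw [hs']; ring
  have hdev : ∀ t, t ≤ N → ‖x t - X t‖ ≤ C * s t := fun t ht => by
    have h1 := htel t ht 0 (by omega)
    rw [add_zero, (hYV t (by omega)).1, pow_zero, mul_one] at h1
    exact h1
  obtain ⟨q, rfl⟩ : ∃ q, k = q + 1 := ⟨k - 1, by omega⟩
  -- The plan at time `t` and `Y t` start at the same state and end at `0` and `Y t (t + k)`.
  have hstep : ∀ t, t < N → e t ≤ C * lam ^ q
      * (‖X (t + (q + 1))‖ + C * lam ^ (q + 1) * ‖x t - X t‖) := fun t ht => by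
    obtain ⟨y, v, hyv, hv⟩ := hpc.2.1 t (by omega)
    obtain ⟨i1, i2, i3⟩ := hYV t (by omega)
    have hyst := hyv.fixedStationary h hS hdk (by omega)
    have hyf := hyv.1.follows
    have hy0 := hyv.1.1
    have hyend := ((isOptimal_originIndicator_iff
      (hS.exists_feasible hdk (by omega) _ _)).1 hyv).1.2
    have h1 := norm_sub_le_of_fixedStationary h hS hT1 hyf
      (i2.mono (le_refl t) (by omega)) hyst
      (i3.fixedStationary.mono le_rfl (by omega) (by omega))
      (by simp [hy0, i1]) hdk (by omega)
    rw [← hlam, ← hC] at h1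
    simp only [add_tsub_cancel_left, hyend, zero_sub, norm_neg] at h1
    have h2 : y 1 = x (t + 1) := by
      have j1 := hyv.1.2 0 (by omega)
      have j2 := hpc.1.2 t (by omega)
      rw [hy0] at j1
      simp only [zero_add, add_zero] at j1 j2
      rw [j1, j2, hv]
    rw [h2] at h1
    have h3 := norm_sub_le_of_freeStationary h hS hT1 i2 (hX.mono (Nat.zero_le t) le_rfl) i3
      (hXst' t (by omega)) (by omega) (by omega : t + (q + 1) ≤ S.T)
    rw [i1, ← hlam, ← hC] at h3
    have h4 : ‖Y t (t + (q + 1))‖ ≤ ‖X (t + (q + 1))‖ + C * lam ^ (q + 1) * ‖x t - X t‖ := by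
      have := norm_le_insert' (Y t (t + (q + 1))) (X (t + (q + 1)))
      linarith
    refine h1.trans ?_
    gcongr
  exact _root_.sum_sq_deviation_le (D := fun t => ‖x t - X t‖) (ξ := fun t => ‖X (t + (q + 1))‖)
    hl0 hl1 (pow_succ _ _).symm hk hε1 rfl hs' (by simp [hx0])
    (fun t => norm_nonneg _) hdev (fun t => norm_nonneg _) hstep

theorem WellConditioned.sum_sq_state_le (h : S.WellConditioned mf ℓf mc ℓc) {N k : ℕ} (hk : 1 ≤ k)
    (hT : N + k = S.T) (x : ℕ → EuclideanSpace ℝ (Fin n)) (u : ℕ → EuclideanSpace ℝ (Fin m)) :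
    mf / 2 * ∑ t ∈ Finset.range N, ‖x (t + k)‖ ^ 2 ≤ S.cost x u := by
  obtain ⟨q, rfl⟩ : ∃ q, k = q + 1 := ⟨k - 1, by omega⟩
  unfold cost
  rw [stepsCost_eq_sum_range, Finset.mul_sum]
  simp only [zero_add]
  have e1 : S.T = (q + N) + 1 := by omega
  rw [e1]
  have h1 : ∀ t, t < S.T → 0 ≤ S.f (t + 1) (x (t + 1)) + S.c (t + 1) (u t) :=
    fun t ht => h.stage_nonneg ht _ _
  rw [Finset.sum_range_succ, Finset.sum_range_add]
  have h2 : 0 ≤ ∑ t ∈ Finset.range q, (S.f (t + 1) (x (t + 1)) + S.c (t + 1) (u t)) :=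
    Finset.sum_nonneg fun t ht => h1 t (by have := Finset.mem_range.1 ht; omega)
  have h3 := h1 (q + N) (by omega)
  have h4 : ∑ t ∈ Finset.range N, mf / 2 * ‖x (t + (q + 1))‖ ^ 2 ≤ ∑ t ∈ Finset.range N,
      (S.f (q + t + 1) (x (q + t + 1)) + S.c (q + t + 1) (u (q + t))) := by
    refine Finset.sum_le_sum fun t ht => ?_
    have ht' := Finset.mem_range.1 ht
    have e2 : t + (q + 1) = q + t + 1 := by ring
    rw [e2]
    have h5 := (h.f_convex (q + t + 1) (by omega) (by omega)).sq_norm_le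
      (h.f_nonneg _ (by omega) (by omega)) (h.f_zero _ (by omega) (by omega)) (x (q + t + 1))
    have h6 := h.c_nonneg (q + t + 1) (by omega) (by omega) (u (q + t))
    linarith
  linarith

end LTVProblem

/-- Assembling the ratio from the cost comparison, the deviation bound and the lower bound on the
optimal cost. -/
theorem ratio_le {C lam ε mf Γ Z Ξ J J' : ℝ} {k : ℕ} (hC : 0 ≤ C) (hl0 : 0 < lam) (hl1 : lam < 1)
    (hε : 0 < ε) (hmf : 0 < mf) (hΓ : 0 ≤ Γ) (hZ0 : 0 ≤ Z) (hJ' : 0 ≤ J')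
    (hJ : J ≤ (1 + lam ^ k) * J' + (1 + 1 / lam ^ k) * (Γ / 2 * Z))
    (hZ : ε * (lam ^ 2 * (1 - lam) ^ 2) * Z ≤ 2 * C ^ 4 * lam ^ (2 * k) * Ξ)
    (hΞ : mf / 2 * Ξ ≤ J') :
    J ≤ (1 + lam ^ k * (1 + 24 * C ^ 4 * (C + 1) ^ 2 * Γ
      / (ε * lam ^ 4 * (1 - lam) ^ 2 * (1 - lam ^ 2) ^ 2 * mf))) * J' := by
  have h1 : 0 < 1 - lam := by linarith
  have h2 : 0 < 1 - lam ^ 2 := by nlinarith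
  set r := lam ^ k with hr
  have hr0 : 0 < r := pow_pos hl0 k
  have hr1 : r ≤ 1 := pow_le_one₀ hl0.le hl1.le
  have e1 : lam ^ (2 * k) = r ^ 2 := by rw [hr, ← pow_mul, mul_comm]
  rw [e1] at hZ
  have h3 : Ξ ≤ 2 / mf * J' := by
    rw [div_mul_eq_mul_div, le_div_iff₀ hmf]; linarith
  have h4 : Z ≤ 4 * C ^ 4 * r ^ 2 / (ε * (lam ^ 2 * (1 - lam) ^ 2) * mf) * J' := by
    have h5 : ε * (lam ^ 2 * (1 - lam) ^ 2) * Z ≤ 2 * C ^ 4 * r ^ 2 * (2 / mf * J') :=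
      hZ.trans (by gcongr)
    rw [← le_div_iff₀' (by positivity)] at h5
    refine h5.trans (le_of_eq ?_)
    field_simp; ring
  have h5 : (1 + 1 / r) * (Γ / 2 * Z) ≤ 1 / r * Γ * Z := by
    have : 1 ≤ 1 / r := by rw [le_div_iff₀ hr0]; linarith
    have h6 : 0 ≤ Γ / 2 * Z := by positivity
    nlinarith
  have h6 : 1 / r * Γ * Z
      ≤ 1 / r * Γ * (4 * C ^ 4 * r ^ 2 / (ε * (lam ^ 2 * (1 - lam) ^ 2) * mf) * J') := by gcongr
  have h7 : 1 / r * Γ * (4 * C ^ 4 * r ^ 2 / (ε * (lam ^ 2 * (1 - lam) ^ 2) * mf) * J')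
      = r * (4 * C ^ 4 * Γ / (ε * (lam ^ 2 * (1 - lam) ^ 2) * mf)) * J' := by
    field_simp
  have h8 : 4 * C ^ 4 * Γ / (ε * (lam ^ 2 * (1 - lam) ^ 2) * mf) ≤ 24 * C ^ 4 * (C + 1) ^ 2 * Γ
      / (ε * lam ^ 4 * (1 - lam) ^ 2 * (1 - lam ^ 2) ^ 2 * mf) := by
    apply div_le_div₀ (by positivity) _ (by positivity) _
    · have : 1 ≤ (C + 1) ^ 2 := by nlinarith
      have i1 : 0 ≤ C ^ 4 * Γ := by positivity
      nlinarith
    · have i1 : lam ^ 2 * (1 - lam ^ 2) ^ 2 ≤ 1 := by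
        have : lam ^ 2 ≤ 1 := by nlinarith
        have : (1 - lam ^ 2) ^ 2 ≤ 1 := by nlinarith [sq_nonneg lam]
        calc lam ^ 2 * (1 - lam ^ 2) ^ 2 ≤ 1 * 1 := by gcongr
          _ = 1 := one_mul 1
      calc ε * lam ^ 4 * (1 - lam) ^ 2 * (1 - lam ^ 2) ^ 2 * mf
          = ε * (lam ^ 2 * (1 - lam) ^ 2) * mf * (lam ^ 2 * (1 - lam ^ 2) ^ 2) := by ring
        _ ≤ ε * (lam ^ 2 * (1 - lam) ^ 2) * mf * 1 := by gcongr
        _ = _ := mul_one _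
  have h9 := mul_le_mul_of_nonneg_right (mul_le_mul_of_nonneg_left h8 hr0.le) hJ'
  linarith

end

theorem theorem4 {n m : ℕ} (S : LTVProblem n m) (d k : ℕ)
    (mf ℓf mc ℓc σ a b b' ε L0 C lam : ℝ)
    (hcost : S.WellConditioned mf ℓf mc ℓc)
    (hctrl : S.UniformlyControllable d σ a b b')
    (hL0 : L0 = constL0 d a b σ ℓf mc ℓc)
    (hC : C = decayConst L0 mf)
    (hlam : lam = decayRate d L0 mf)
    (hdk : d ≤ k) (hkT : k ≤ S.T)
    (hε0 : 0 < ε) (hε1 : ε < 1)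
    (hk : Real.log (6 * C ^ 6 / ((1 - ε) * lam ^ 2 * (1 - lam) ^ 2 * (1 - lam ^ 2) ^ 2))
      / (4 * Real.log (1 / lam)) ≤ (k : ℝ)) :
    (∃ x u, S.IsPredictiveControl k originIndicator x u) ∧
    ∀ x u, S.IsPredictiveControl k originIndicator x u →
      S.cost x u ≤
        (1 + lam ^ k * (1 + 24 * C ^ 4 * (C + 1) ^ 2
            * (2 * ℓf + 4 * b' ^ 2 * ℓc + 4 * a ^ 2 * b' ^ 2 * ℓc + L0 + ℓf)
            / (ε * lam ^ 4 * (1 - lam) ^ 2 * (1 - lam ^ 2) ^ 2 * mf))) * S.optCost := by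
  refine ⟨LTVProblem.exists_isPredictiveControl hcost hctrl hdk hkT, fun x u hpc => ?_⟩
  obtain ⟨N, hN⟩ := Nat.exists_eq_add_of_le' hkT
  have hd := hctrl.d_pos
  have hmf := hcost.mf_pos
  have hℓf := hcost.ℓf_pos
  have hℓc := hcost.ℓc_pos
  have hL : 0 < L0 := hL0 ▸ LTVProblem.constL0_pos hcost hctrl
  have hC1 : 1 ≤ C := hC ▸ decayConst_ge_one hL hmf
  obtain ⟨hl0, hl1⟩ := decayRate_mem hd hL hmf
  rw [← hlam] at hl0 hl1
  obtain ⟨X, U, hopt⟩ := hcost.exists_isOptimal_zero (t := 0) (p := S.T) (by omega) S.x0 S.w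
  rw [LTVProblem.optCost_eq hopt]
  have hcost0 : 0 ≤ S.cost X U := by
    have := hcost.sum_sq_state_le (N := N) (by omega) hN.symm X U
    refine le_trans ?_ this
    positivity
  have hk' := mul_pow_le_of_log_div_le (zero_lt_one.trans_le hC1) hl0 hl1 hε1 hk
  rcases Nat.eq_zero_or_pos N with rfl | hN0
  · -- with a window as long as the horizon, predictive control is the offline optimum
    rw [zero_add] at hN
    obtain ⟨htraj, -, y, v, hyv, huv⟩ := hpc
    rw [← hN] at hyv huv
    simp only [Nat.sub_self, zero_add] at hyv huv
    rw [htraj.1] at hyv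
    have h1 : S.cost x u = S.stepsCost 0 S.T y v :=
      LTVProblem.stepsCost_congr (htraj.eq_of_input_eq hyv.1 huv) huv
    have h2 : S.stepsCost 0 S.T y v ≤ S.cost X U :=
      (LTVProblem.isOptimal_zero_iff.1 hyv).2 X U hopt.1
    rw [h1]
    refine h2.trans (le_mul_of_one_le_left hcost0 (le_add_of_nonneg_right ?_))
    have h3 : 0 ≤ 2 * ℓf + 4 * b' ^ 2 * ℓc + 4 * a ^ 2 * b' ^ 2 * ℓc + L0 + ℓf := by positivity
    have h4 := zero_le_one.trans hC1
    exact mul_nonneg (pow_nonneg hl0.le k) (add_nonneg zero_le_one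
      (div_nonneg (mul_nonneg (by positivity) h3) (by positivity)))
  · have hT1 : 1 < S.T := by omega
    refine ratio_le (by linarith) hl0 hl1 hε0 hmf (by positivity)
      (Finset.sum_nonneg fun t _ => sq_nonneg _) hcost0 ?_
      (hpc.sum_sq_deviation_le hcost hctrl hdk hN.symm hT1 hopt hL0 hC hlam hε1 hk')
      (hcost.sum_sq_state_le (by omega) hN.symm X U)
    rw [hL0]
    exact hpc.cost_le hcost hctrl hdk hN.symm hN0 hopt.1 (pow_pos hl0 k)
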